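/- Let $n\ge 1$, let $p(t)=\sum_{k=0}^n a_kt^k\in\mathbb C[t]$ be a separable monic polynomial of degree $n$ (so $a_n=1$) with $a_0\neq 0$, let $R=\mathbb C[t,t^{-1},u\mid u^2=p(t)]$, and let $\mathfrak g$ be a finite-dimensional simple complex Lie algebra with Killing form $(\cdot,\cdot)$. Let $\Omega^1_R/dR$ be the space of Kähler differentials of $R$ over $\mathbb C$ modulo exact forms, write $\overline{\eta}$ for the class of a differential $\eta$, and put $$\omega_0=\overline{t^{-1}dt},\qquad \omega_k=\overline{t^{-k}u\,dt}\quad(1\le k\le n).$$ For $-n\le i\le -1$ define complex numbers $P_{k,i}$ ($k\ge -n$) and $Q_{m,i}$ ($m\ge 1$) by $$P_{k,i}=\delta_{k,i}\ (-n\le k\le -1),\qquad (2k+n+2)P_{k,i}=-\sum_{j=0}^{n-1}(3j+2k-2n+2)\,a_jP_{k-n+j,i}\ (k\ge 0),$$ $$Q_{m,i}=\delta_{m,-i}\ (1\le m\le n),\qquad -2(m-1)a_0Q_{m,i}=-\sum_{j=1}^{n}(3j-2m+2)\,a_jQ_{m-j,i}\ (m\ge n+1),$$ and for $i,j\in\mathbb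 Z$ put $$\psi_{ij}=\begin{cases}\sum_{k=1}^nP_{i+j-1,-k}\,\omega_k & \text{if } i+j\ge -n+1,\\ \sum_{k=1}^nQ_{-i-j+1,-k}\,\omega_k & \text{if } i+j<-n+1.\end{cases}$$ Then $\omega_0,\dots,\omega_n$ is a basis of $\Omega^1_R/dR$, and the vector space $$\widehat{\mathfrak g}=(\mathfrak g\otimes R)\oplus\Omega^1_R/dR=\widehat{\mathfrak g}^0\oplus\widehat{\mathfrak g}^1,$$ $$\widehat{\mathfrak g}^0=(\mathfrak g\otimes\mathbb C[t,t^{-1}])\oplus\mathbb C\omega_0,\qquad \widehat{\mathfrak g}^1=(\mathfrak g\otimes\mathbb C[t,t^{-1}]u)\oplus\bigoplus_{k=1}^n\mathbb C\omega_k,$$ is a $\mathbb Z_2$-graded Lie algebra in which all $\omega_k$ are central and, for $x,y\in\mathfrak g$ and $i,j\in\mathbb Z$, $$[x\otimes t^i,\,y\otimes t^j]=[x,y]\otimes t^{i+j}+\delta_{i+j,0}\,j\,(x,y)\,\omega_0,$$ $$[x\otimes t^iu,\,y\otimes t^ju]=[x,y]\otimes t^{i+j}p(t)+(x,y)\sum_{k=0}^n\left(j+\tfrac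 k2\right)a_k\,\delta_{i+j,-k}\,\omega_0,$$ $$[x\otimes t^iu,\,y\otimes t^j]=[x,y]\otimes t^{i+j}u+j\,(x,y)\,\psi_{ij}.$$ Together with the projection $\widehat{\mathfrak g}\to\mathfrak g\otimes R$ it is the universal central extension of $\mathfrak g\otimes R$: the projection is a surjective Lie algebra homomorphism with central kernel, and for every central extension $\rho:E\to\mathfrak g\otimes R$ there is exactly one Lie algebra homomorphism $\widehat{\mathfrak g}\to E$ over $\mathfrak g\otimes R$. -/

import Mathlib

universe u w

open scoped TensorProduct LaurentPolynomial Polynomial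

noncomputable section

section CentralExtensions

variable {k L M : Type*} [CommRing k] [LieRing L] [LieAlgebra k L] [LieRing M] [LieAlgebra k M]

/-- A Lie algebra homomorphism `π : L → M` is a central extension of `M` if it is surjective and
its kernel is contained in the center of `L`. -/
def IsCentralExtension (π : L →ₗ⁅k⁆ M) : Prop :=
  Function.Surjective π ∧ ∀ z : L, π z = 0 → ∀ v : L, ⁅z, v⁆ = 0

/-- A central extension `π : L → M` is universal if for every central extension `ρ : E → M` there
is exactly one Lie algebra homomorphism `φ : L → E` with `ρ ∘ φ = π`. -/
def IsUniversalCentralExtension (π : L →ₗ⁅k⁆ M) : Prop :=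
  IsCentralExtension π ∧
    ∀ (E : Type w) [LieRing E] [LieAlgebra k E] (ρ : E →ₗ⁅k⁆ M), IsCentralExtension ρ →
      ∃! φ : L →ₗ⁅k⁆ E, ρ.comp φ = π

end CentralExtensions

namespace Hyperelliptic

/-- The coordinate ring `R = ℂ[t, t⁻¹, u | u² = p(t)]`. -/
abbrev CoordRing (p : ℂ[X]) : Type :=
  AdjoinRoot (Polynomial.X ^ 2 - Polynomial.C (Polynomial.toLaurent p) : ℂ[T;T⁻¹][X])

/-- The inclusion `ℂ[t, t⁻¹] → R`. -/
def ofLaurent (p : ℂ[X]) : ℂ[T;T⁻¹] →ₐ[ℂ] CoordRing p :=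
  IsScalarTower.toAlgHom ℂ ℂ[T;T⁻¹] (CoordRing p)

/-- The element `t ^ i` of `R`, for an integer `i`. -/
def t (p : ℂ[X]) (i : ℤ) : CoordRing p := ofLaurent p (LaurentPolynomial.T i)

/-- The element `u` of `R`. -/
def u (p : ℂ[X]) : CoordRing p := AdjoinRoot.root _

/-- The element `p(t)` of `R`. -/
def pt (p : ℂ[X]) : CoordRing p := ofLaurent p (Polynomial.toLaurent p)

/-- `Ω¹_R / dR`: Kähler differentials modulo exact forms, a complex vector space. -/
abbrev DifferentialsModExact (p : ℂ[X]) : Type :=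
  KaehlerDifferential ℂ (CoordRing p) ⧸
    LinearMap.range (KaehlerDifferential.D ℂ (CoordRing p) :
      CoordRing p →ₗ[ℂ] KaehlerDifferential ℂ (CoordRing p))

/-- The class of `f dh` in `Ω¹_R / dR`. -/
def formClass (p : ℂ[X]) (f h : CoordRing p) : DifferentialsModExact p :=
  Submodule.Quotient.mk (f • KaehlerDifferential.D ℂ (CoordRing p) h)

/-- `ω₀` is the class of `t⁻¹ dt`, and `ω_k` is the class of `t⁻ᵏ u dt` for `k ≥ 1`. -/
def omega (p : ℂ[X]) (k : ℕ) : DifferentialsModExact p :=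
  if k = 0 then formClass p (t p (-1)) (t p 1) else formClass p (t p (-(k : ℤ)) * u p) (t p 1)

/-- The values `P_{k,i}(a₀, …, a_{n-1})`, for `k ≥ -n`: equal to `δ_{k,i}` for `-n ≤ k ≤ -1`, and
given for `k ≥ 0` by
`(2k + n + 2) P_{k,i} = - ∑_{j=0}^{n-1} (3j + 2k - 2n + 2) a_j P_{k-n+j,i}`. -/
def P (n : ℕ) (a : ℕ → ℂ) (k i : ℤ) : ℂ :=
  if k < 0 then (if k = i then 1 else 0)
  else -(∑ j : Fin n, (3 * (j : ℂ) + 2 * (k : ℂ) - 2 * (n : ℂ) + 2) * a j * P n a (k - n + j) i) /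
    (2 * (k : ℂ) + n + 2)
termination_by (k + n).toNat
decreasing_by have := j.isLt; omega

/-- The values `Q_{m,i}(a₀, …, a_n)`, for `m ≥ 1`: equal to `δ_{m,-i}` for `1 ≤ m ≤ n`, and
given for `m ≥ n + 1` by
`-2(m - 1) a₀ Q_{m,i} = - ∑_{j=1}^n (3j - 2m + 2) a_j Q_{m-j,i}`. -/
def Q (n : ℕ) (a : ℕ → ℂ) (m i : ℤ) : ℂ :=
  if m ≤ n then (if m = -i then 1 else 0)
  else -(∑ j : Fin n, (3 * ((j : ℂ) + 1) - 2 * (m : ℂ) + 2) * a (j + 1) * Q n a (m - (j + 1)) i) /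
    (-2 * ((m : ℂ) - 1) * a 0)
termination_by m.toNat
decreasing_by have := j.isLt; omega

theorem P_init (n : ℕ) (a : ℕ → ℂ) (k i : ℤ) (hk : k ≤ -1) :
    P n a k i = if k = i then 1 else 0 := by
  rw [P, if_pos (by omega)]

theorem P_rec (n : ℕ) (a : ℕ → ℂ) (k i : ℤ) (hk : 0 ≤ k) :
    (2 * (k : ℂ) + n + 2) * P n a k i =
      -∑ j ∈ Finset.range n,
        (3 * (j : ℂ) + 2 * (k : ℂ) - 2 * (n : ℂ) + 2) * a j * P n a (k - n + j) i := by
  have h : (2 * (k : ℂ) + n + 2) ≠ 0 := by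
    have : (2 * k + n + 2 : ℤ) ≠ 0 := by omega
    exact_mod_cast this
  rw [P, if_neg (by omega), mul_div_cancel₀ _ h, Finset.sum_range]

theorem Q_init (n : ℕ) (a : ℕ → ℂ) (m i : ℤ) (hm : m ≤ n) :
    Q n a m i = if m = -i then 1 else 0 := by
  rw [Q, if_pos hm]

theorem Q_rec (n : ℕ) (a : ℕ → ℂ) (ha : a 0 ≠ 0) (hn : 1 ≤ n) (m i : ℤ) (hm : (n : ℤ) + 1 ≤ m) :
    -2 * ((m : ℂ) - 1) * a 0 * Q n a m i =
      -∑ j ∈ Finset.Icc 1 n, (3 * (j : ℂ) - 2 * (m : ℂ) + 2) * a j * Q n a (m - j) i := by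
  have h1 : ((m : ℂ) - 1) ≠ 0 := by
    have : (m - 1 : ℤ) ≠ 0 := by omega
    exact_mod_cast this
  have h : -2 * ((m : ℂ) - 1) * a 0 ≠ 0 :=
    mul_ne_zero (mul_ne_zero (by norm_num) h1) ha
  rw [Q, if_neg (by omega), mul_div_cancel₀ _ h, ← Finset.Ico_add_one_right_eq_Icc,
    Finset.sum_Ico_eq_sum_range, Finset.sum_range]
  simp [add_comm]

/-- The elements `ψ_{ij}` of `Ω¹_R / dR`, with `n = deg p` and `a_k` the coefficients of `p`. -/
def psi (p : ℂ[X]) (i j : ℤ) : DifferentialsModExact p :=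
  if -(p.natDegree : ℤ) + 1 ≤ i + j then
    ∑ k ∈ Finset.Icc 1 p.natDegree, P p.natDegree p.coeff (i + j - 1) (-(k : ℤ)) • omega p k
  else
    ∑ k ∈ Finset.Icc 1 p.natDegree, Q p.natDegree p.coeff (-i - j + 1) (-(k : ℤ)) • omega p k

section Space

variable (p : ℂ[X]) (g : Type*) [LieRing g] [LieAlgebra ℂ g]

/-- The vector space `(𝔤 ⊗ R) ⊕ Ω¹_R / dR`; the element `x ⊗ f` of `𝔤 ⊗ R` is written `f ⊗ₜ x`. -/
abbrev Space : Type _ := (CoordRing p ⊗[ℂ] g) × DifferentialsModExact p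

/-- `(𝔤 ⊗ ℂ[t, t⁻¹]) ⊕ ℂ ω₀`. -/
def evenPart : Submodule ℂ (Space p g) :=
  (LinearMap.range (LinearMap.rTensor g (ofLaurent p).toLinearMap)).prod
    (Submodule.span ℂ {omega p 0})

/-- `(𝔤 ⊗ ℂ[t, t⁻¹] u) ⊕ ⨁_{k=1}^n ℂ ω_k`. -/
def oddPart : Submodule ℂ (Space p g) :=
  (LinearMap.range (LinearMap.rTensor g
    (LinearMap.mulRight ℂ (u p) ∘ₗ (ofLaurent p).toLinearMap))).prod
    (Submodule.span ℂ (omega p '' Set.Icc 1 p.natDegree))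

/-- The two parts, indexed by `ℤ / 2`. -/
def part (r : ZMod 2) : Submodule ℂ (Space p g) :=
  if r = 0 then evenPart p g else oddPart p g

end Space

end Hyperelliptic

end

/-!
The Lie algebra is the central extension of `𝔤 ⊗ R` by `Ω¹_R / dR` with cocycle
`(x ⊗ f, y ⊗ h) ↦ (x, y) f dh`. Two independent facts are needed.

**Universality** (Kassel's theorem, `CurrentAlgebra.isUniversalCentralExtension_proj`, valid for
every commutative algebra `A` over an algebraically closed field of characteristic zero). Let
`ρ : E → A ⊗ 𝔤` be a central extension. The bracket in `E` of lifts of `a` and `b` does not depend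
on the lifts; write it `F(a, b)`. With dual bases `bᵢ`, `bⁱ` of `𝔤` for the Killing form, put
`ψ(a) = ∑ F(bᵢ, ⁅bⁱ, a⁆)`. The Casimir element acts on the adjoint representation as the identity,
so `ψ` is a section of `ρ`; its invariance gives `ψ ⁅z, a⁆ = F(z, a)` for `z ∈ 𝔤`
(`casimirSection_lie`). This replaces the appeals to Whitehead's lemma and to Weyl's theorem. Hence
the cocycle `τ(a, b) = F(a, b) - ψ ⁅a, b⁆` vanishes for `a ∈ 𝔤` and is therefore `𝔤`-invariant. By
Schur's lemma `τ(f ⊗ x, h ⊗ y) = (x, y) φ(f, h)`, and the cocycle identity makes `φ` satisfy the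
Leibniz rule in `h` and vanish at `f = 1`, so that `φ` factors through `f dh` as a map `θ` on
`Ω¹_A / dA` (`exists_eq_comp_cocycle`). Then `(a, c) ↦ ψ(a) + θ(c)` is the required homomorphism. It
is unique because the extension is perfect.

**The basis of `Ω¹_R / dR`.** Since `2 u du = p' dt`, exactness of `d(t ^ m p u)` gives the
recurrence `∑ⱼ (2 m + 3 j) aⱼ t ^ (m - 1 + j) u dt = 0` for all integers `m`
(`sum_smul_formClass_tu`). It can be solved upwards (leading coefficient `aₙ = 1`) and downwards
(constant coefficient `a₀ ≠ 0`) from `k = -n, …, -1`, which is what `P` and `Q` do;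
so the `ω_k` span.
For linear independence, every sequence `c` satisfying the recurrence gives a functional on
`Ω¹_R / dR` with `t ^ k u dt ↦ c k` (`exists_functional`): in the coordinates of `R` over the basis
`1, u` of `R` over `ℂ[t, t⁻¹]` it is given by an explicit bilinear map `pairing`, and the recurrence
is exactly the Leibniz rule for it. The solutions `P`, `Q` themselves yield the functionals dual
to `ω_1, …, ω_n`, and the residue is dual to `ω_0`.
-/

noncomputable section

/-! ### Dual bases and invariant forms for simple Lie algebras -/

namespace LieAlgebra

variable {k g : Type*} [Field k] [LieRing g] [LieAlgebra k g]

section Casimir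

variable [IsKilling k g] {ι : Type*} [Fintype ι] [DecidableEq ι]
  (b : Module.Basis ι k g)

/-- The basis dual to `b` for the Killing form. -/
def killingDualBasis [FiniteDimensional k g] : Module.Basis ι k g :=
  (killingForm k g).dualBasis (IsKilling.killingForm_nondegenerate k g) b

variable [FiniteDimensional k g]

theorem killingForm_killingDualBasis (i j : ι) :
    killingForm k g (b i) (killingDualBasis b j) = if i = j then 1 else 0 :=
  LinearMap.BilinForm.apply_dualBasis_right (IsKilling.killingForm_nondegenerate k g)
    ⟨LieModule.traceForm_comm k g g⟩ b i j

theorem sum_killingForm_dual_smul (x : g) :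
    ∑ i, killingForm k g x (killingDualBasis b i) • b i = x := by
  refine LinearMap.ker_eq_bot.mp (IsKilling.ker_killingForm_eq_bot k g) ?_
  refine (killingDualBasis b).ext fun j => ?_
  simp [killingForm_killingDualBasis]

theorem sum_killingForm_smul_dual (x : g) :
    ∑ i, killingForm k g x (b i) • killingDualBasis b i = x := by
  conv_rhs => rw [← (killingDualBasis b).sum_repr x]
  simp [killingDualBasis, LinearMap.BilinForm.dualBasis_repr_apply]

/-- The tensor `∑ bᵢ ⊗ bⁱ` of dual bases is invariant under the adjoint action. -/
theorem sum_dualBasis_lie_invariant {W : Type*} [AddCommGroup W] [Module k W]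
    (F : g →ₗ[k] g →ₗ[k] W) (z : g) :
    ∑ i, F (b i) ⁅killingDualBasis b i, z⁆ = ∑ i, F ⁅z, b i⁆ (killingDualBasis b i) := by
  have h1 (i : ι) : F (b i) ⁅killingDualBasis b i, z⁆ =
      ∑ j, killingForm k g ⁅z, b j⁆ (killingDualBasis b i) • F (b i) (killingDualBasis b j) := by
    conv_lhs => rw [← sum_killingForm_smul_dual b ⁅killingDualBasis b i, z⁆]
    rw [map_sum]
    refine Finset.sum_congr rfl fun j _ => ?_
    rw [map_smul, LieModule.traceForm_apply_lie_apply, LieModule.traceForm_comm]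
  have h2 (j : ι) : F ⁅z, b j⁆ (killingDualBasis b j) =
      ∑ i, killingForm k g ⁅z, b j⁆ (killingDualBasis b i) • F (b i) (killingDualBasis b j) := by
    conv_lhs => rw [← sum_killingForm_dual_smul b ⁅z, b j⁆]
    simp [map_sum]
  simp_rw [h1, h2]
  exact Finset.sum_comm

/-- The Casimir element of the Killing form acts as the identity in the adjoint representation:
pairing with `y` under the Killing form gives the trace of `ad x ∘ ad y`. -/
theorem sum_lie_lie_dualBasis (x : g) :
    ∑ i, ⁅b i, ⁅killingDualBasis b i, x⁆⁆ = x := by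
  refine LinearMap.ker_eq_bot.mp (IsKilling.ker_killingForm_eq_bot k g) ?_
  ext y
  rw [killingForm_apply_apply k g x y, LinearMap.trace_eq_matrix_trace k b, Matrix.trace, map_sum,
    LinearMap.sum_apply]
  refine Finset.sum_congr rfl fun i _ => ?_
  have h (v : g) : b.repr v i = killingForm k g v (killingDualBasis b i) := by
    conv_rhs => rw [← b.sum_repr v]
    simp only [map_sum, LinearMap.sum_apply, map_smul, LinearMap.smul_apply,
      killingForm_killingDualBasis]
    simp
  have h₁ := LieModule.traceForm_apply_lie_apply' k g g (b i) ⁅killingDualBasis b i, x⁆ y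
  have h₂ := LieModule.traceForm_apply_lie_apply' k g g x ⁅y, b i⁆ (killingDualBasis b i)
  rw [Matrix.diag_apply, LinearMap.toMatrix_apply, h, LinearMap.comp_apply, ad_apply, ad_apply,
    h₁, h₂, LieModule.traceForm_comm, ← lie_skew y (b i), ← lie_skew x (killingDualBasis b i)]
  simp only [map_neg, LinearMap.neg_apply, neg_neg]

end Casimir

section Simple

variable [IsSimple k g]

theorem span_lie_eq_top : Submodule.span k {z : g | ∃ x y : g, ⁅x, y⁆ = z} = ⊤ := by
  have h : ⁅(⊤ : LieIdeal k g), (⊤ : LieIdeal k g)⁆ = ⊤ := by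
    refine (IsSimple.eq_bot_or_eq_top (R := k) _).resolve_left fun h => ?_
    refine IsSimple.non_abelian (R := k) (L := g) ⟨fun x y => ?_⟩
    have : ⁅x, y⁆ ∈ ⁅(⊤ : LieIdeal k g), (⊤ : LieIdeal k g)⁆ :=
      LieSubmodule.lie_mem_lie (LieSubmodule.mem_top x) (LieSubmodule.mem_top y)
    simpa [h] using this
  have h' := congrArg LieSubmodule.toSubmodule h
  rw [LieSubmodule.lieIdeal_oper_eq_linear_span'] at h'
  simpa using h'

variable [FiniteDimensional k g]

/-- Schur's lemma for the adjoint representation of a simple Lie algebra. -/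
theorem exists_eq_smul_of_lie_comm [IsAlgClosed k] (T : g →ₗ[k] g)
    (hT : ∀ x y : g, T ⁅x, y⁆ = ⁅x, T y⁆) :
    ∃ c : k, ∀ x, T x = c • x := by
  have : Nontrivial g := by
    by_contra h
    rw [not_nontrivial_iff_subsingleton] at h
    exact IsSimple.non_abelian (R := k) (L := g) inferInstance
  obtain ⟨c, hc⟩ := Module.End.exists_eigenvalue T
  let I : LieIdeal k g :=
    { Module.End.eigenspace T c with
      lie_mem := by
        intro x m hm
        have hm' : T m = c • m := Module.End.mem_eigenspace_iff.mp hm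
        refine Module.End.mem_eigenspace_iff.mpr ?_
        rw [hT, hm', lie_smul] }
  have hI : I = ⊤ := by
    refine (IsSimple.eq_bot_or_eq_top I).resolve_left fun h => hc ?_
    have := congrArg LieSubmodule.toSubmodule h
    simpa [I] using this
  refine ⟨c, fun x => ?_⟩
  have hx : x ∈ I := hI ▸ LieSubmodule.mem_top x
  exact Module.End.mem_eigenspace_iff.mp hx

variable [CharZero k]

theorem exists_killingForm_lie_eq_one : ∃ x y z : g, killingForm k g ⁅x, y⁆ z = 1 := by
  by_contra! h
  refine IsSimple.non_abelian (R := k) (L := g) ⟨fun x y => ?_⟩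
  have : ⁅x, y⁆ ∈ LinearMap.ker (killingForm k g) := by
    ext z
    by_contra hz
    exact h x y ((killingForm k g ⁅x, y⁆ z)⁻¹ • z) (by
      rw [map_smul, smul_eq_mul]; exact inv_mul_cancel₀ hz)
  simpa using this

/-- A vector-valued invariant bilinear form on a simple Lie algebra is a multiple of the
Killing form. -/
theorem invariant_eq_killingForm_smul [IsAlgClosed k] {W : Type*} [AddCommGroup W] [Module k W]
    (β : g →ₗ[k] g →ₗ[k] W) (hβ : ∀ z x y : g, β ⁅z, x⁆ y = -β x ⁅z, y⁆)
    {x₀ y₀ : g} (h₀ : killingForm k g x₀ y₀ = 1) (x y : g) :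
    β x y = killingForm k g x y • β x₀ y₀ := by
  rw [← sub_eq_zero, ← Module.forall_dual_apply_eq_zero_iff k]
  intro ξ
  -- the scalar form `ξ ∘ β` is represented by an endomorphism commuting with `ad`
  let e := (killingForm k g).toDual (IsKilling.killingForm_nondegenerate k g)
  let T : g →ₗ[k] g := e.symm.toLinearMap ∘ₗ (β.compr₂ ξ)
  have hT (a c : g) : killingForm k g (T a) c = ξ (β a c) := by
    have : e (T a) = (β.compr₂ ξ) a := by simp [T]
    rw [← LinearMap.BilinForm.toDual_def (IsKilling.killingForm_nondegenerate k g)]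
    exact congrArg (fun f => f c) this
  obtain ⟨c, hc⟩ := exists_eq_smul_of_lie_comm (k := k) T (by
    intro a d
    refine LinearMap.ker_eq_bot.mp (IsKilling.ker_killingForm_eq_bot k g) ?_
    ext z
    rw [hT, LieModule.traceForm_apply_lie_apply', hT, hβ, map_neg])
  have hc' (a d : g) : ξ (β a d) = c * killingForm k g a d := by
    rw [← hT, hc, map_smul, LinearMap.smul_apply, smul_eq_mul]
  rw [map_sub, map_smul, hc', hc', h₀, smul_eq_mul]
  ring

end Simple

end LieAlgebra

/-! ### Differentials modulo exact forms -/

namespace KaehlerDifferential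

variable (k A : Type*) [CommRing k] [CommRing A] [Algebra k A]

/-- Kähler differentials modulo exact forms. -/
abbrev ModExact : Type _ := Ω[A⁄k] ⧸ LinearMap.range (D k A : A →ₗ[k] Ω[A⁄k])

/-- The bilinear map sending `(f, h)` to the class of `f dh` modulo exact forms. -/
def modExactClass : A →ₗ[k] A →ₗ[k] ModExact k A :=
  (LinearMap.lsmul A Ω[A⁄k]).restrictScalars₁₂ k k |>.compl₁₂ LinearMap.id
    (D k A : A →ₗ[k] Ω[A⁄k]) |>.compr₂ (Submodule.mkQ _)

variable {k A}

theorem modExactClass_apply (f h : A) :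
    modExactClass k A f h = Submodule.Quotient.mk (f • D k A h) := rfl

theorem modExactClass_mul_right (f g h : A) :
    modExactClass k A f (g * h) = modExactClass k A (f * g) h + modExactClass k A (f * h) g := by
  simp only [modExactClass_apply, Derivation.leibniz, smul_add, smul_smul,
    Submodule.Quotient.mk_add]

theorem modExactClass_one_left (h : A) : modExactClass k A 1 h = 0 := by
  rw [modExactClass_apply, one_smul, Submodule.Quotient.mk_eq_zero]
  exact ⟨h, rfl⟩

theorem modExactClass_one_right (f : A) : modExactClass k A f 1 = 0 := by
  simp [modExactClass_apply]

theorem modExactClass_swap (f h : A) : modExactClass k A f h = -modExactClass k A h f := by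
  have := modExactClass_mul_right (k := k) 1 f h
  rw [modExactClass_one_left, one_mul, one_mul] at this
  exact eq_neg_of_add_eq_zero_left this.symm

theorem span_modExactClass_eq_top :
    Submodule.span k {c | ∃ f h : A, modExactClass k A f h = c} = ⊤ := by
  rw [eq_top_iff]
  rintro c -
  obtain ⟨η, rfl⟩ := Submodule.Quotient.mk_surjective _ c
  suffices h : ∀ a : A, (Submodule.Quotient.mk (a • η) : ModExact k A) ∈
      Submodule.span k {c | ∃ f h : A, modExactClass k A f h = c} by
    simpa using h 1
  have hη : η ∈ Submodule.span A (Set.range (D k A)) := by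
    rw [span_range_derivation]; trivial
  induction hη using Submodule.span_induction with
  | mem x hx =>
    obtain ⟨h, rfl⟩ := hx
    exact fun a => Submodule.subset_span ⟨a, h, rfl⟩
  | zero => simp
  | add x y _ _ hx hy =>
    intro a
    rw [smul_add, Submodule.Quotient.mk_add]
    exact Submodule.add_mem _ (hx a) (hy a)
  | smul b x _ hx => intro a; rw [smul_smul]; exact hx _

theorem modExact_ext {V : Type*} [AddCommGroup V] [Module k V] {θ θ' : ModExact k A →ₗ[k] V}
    (h : ∀ f g : A, θ (modExactClass k A f g) = θ' (modExactClass k A f g)) : θ = θ' := by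
  refine LinearMap.ext_on span_modExactClass_eq_top ?_
  rintro _ ⟨f, g, rfl⟩
  exact h f g

section Lift

variable {V : Type*} [AddCommGroup V] [Module k V]

/-- The `k`-linear maps `A → V`, on which `A` acts by multiplication on the source. -/
def SourceHom (k A V : Type*) [CommRing k] [CommRing A] [Algebra k A] [AddCommGroup V]
    [Module k V] : Type _ := A →ₗ[k] V

instance : AddCommGroup (SourceHom k A V) := inferInstanceAs (AddCommGroup (A →ₗ[k] V))

instance : Module k (SourceHom k A V) := inferInstanceAs (Module k (A →ₗ[k] V))

instance : Module A (SourceHom k A V) where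
  smul a ℓ := LinearMap.comp (show A →ₗ[k] V from ℓ) (LinearMap.mulLeft k a)
  one_smul ℓ := LinearMap.ext fun f => congrArg (show A →ₗ[k] V from ℓ) (one_mul f)
  mul_smul a b ℓ := LinearMap.ext fun f => congrArg (show A →ₗ[k] V from ℓ) (by
    simp only [LinearMap.mulLeft_apply]; ring)
  smul_zero _ := rfl
  smul_add _ _ _ := rfl
  add_smul a b ℓ := LinearMap.ext fun f => by
    refine (congrArg (show A →ₗ[k] V from ℓ) (add_mul a b f)).trans ?_
    exact map_add (show A →ₗ[k] V from ℓ) _ _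
  zero_smul ℓ := LinearMap.ext fun f => by
    refine (congrArg (show A →ₗ[k] V from ℓ) (zero_mul f)).trans ?_
    exact map_zero (show A →ₗ[k] V from ℓ)

instance : IsScalarTower k A (SourceHom k A V) where
  smul_assoc c a ℓ := LinearMap.ext fun f => by
    refine (congrArg (show A →ₗ[k] V from ℓ) (smul_mul_assoc c a f)).trans ?_
    exact map_smul (show A →ₗ[k] V from ℓ) _ _

/-- A bilinear map `φ` that satisfies the Leibniz rule in its second argument is a derivation
`h ↦ φ(·, h)` with values in `A → V`. -/
def sourceHomDerivation (φ : A →ₗ[k] A →ₗ[k] V)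
    (hφ : ∀ f g h, φ f (g * h) = φ (f * g) h + φ (f * h) g) : Derivation k A (SourceHom k A V) :=
  Derivation.mk' (φ.flip : A →ₗ[k] (A →ₗ[k] V)) fun g h => LinearMap.ext fun f => by
    change φ f (g * h) = φ (g * f) h + φ (h * f) g
    rw [hφ, mul_comm g f, mul_comm h f]

/-- The universal property of differentials modulo exact forms: a bilinear map `φ` satisfying the
Leibniz rule in its second argument and vanishing at `(1, h)` factors through `f dh`. -/
def modExactLift (φ : A →ₗ[k] A →ₗ[k] V)
    (hφ : ∀ f g h, φ f (g * h) = φ (f * g) h + φ (f * h) g) (h1 : ∀ h, φ 1 h = 0) :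
    ModExact k A →ₗ[k] V :=
  Submodule.liftQ _
    ((LinearMap.applyₗ (1 : A) : (A →ₗ[k] V) →ₗ[k] V) ∘ₗ
      ((sourceHomDerivation φ hφ).liftKaehlerDifferential.restrictScalars k :
        Ω[A⁄k] →ₗ[k] SourceHom k A V)) <| by
    rintro _ ⟨h, rfl⟩
    refine (congrArg (fun ℓ : SourceHom k A V => (show A →ₗ[k] V from ℓ) 1)
      ((sourceHomDerivation φ hφ).liftKaehlerDifferential_comp_D h)).trans ?_
    exact h1 h

theorem modExactLift_apply (φ : A →ₗ[k] A →ₗ[k] V)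
    (hφ : ∀ f g h, φ f (g * h) = φ (f * g) h + φ (f * h) g) (h1 : ∀ h, φ 1 h = 0) (f h : A) :
    modExactLift φ hφ h1 (modExactClass k A f h) = φ f h := by
  have h2 : (sourceHomDerivation φ hφ).liftKaehlerDifferential (f • D k A h) =
      f • sourceHomDerivation φ hφ h := by
    rw [map_smul, Derivation.liftKaehlerDifferential_comp_D]
  refine (congrArg (fun ℓ : SourceHom k A V => (show A →ₗ[k] V from ℓ) 1) h2).trans ?_
  change φ (f * 1) h = φ f h
  rw [mul_one]

end Lift

end KaehlerDifferential

/-! ### The universal central extension of a current algebra -/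

namespace CurrentAlgebra

open KaehlerDifferential

variable (k A g : Type*) [Field k] [CommRing A] [Algebra k A] [LieRing g] [LieAlgebra k g]

/-- The two-cocycle `(f ⊗ x, h ⊗ y) ↦ (x, y) f dh` of `A ⊗ g`, where `(x, y)` is the Killing
form, with values in the differentials modulo exact forms. -/
def cocycle : A ⊗[k] g →ₗ[k] A ⊗[k] g →ₗ[k] ModExact k A :=
  (TensorProduct.map₂ (modExactClass k A) (killingForm k g)).compr₂
    (TensorProduct.rid k (ModExact k A)).toLinearMap

variable {k A g}

theorem cocycle_tmul (f h : A) (x y : g) :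
    cocycle k A g (f ⊗ₜ x) (h ⊗ₜ y) = killingForm k g x y • modExactClass k A f h := by
  simp [cocycle]

theorem cocycle_swap (a b : A ⊗[k] g) : cocycle k A g a b = -cocycle k A g b a := by
  induction a with
  | zero => simp
  | add a a' ha ha' => simp only [map_add, LinearMap.add_apply, ha, ha', neg_add]
  | tmul f x =>
    induction b with
    | zero => simp
    | add b b' hb hb' => simp only [map_add, LinearMap.add_apply, hb, hb', neg_add]
    | tmul h y =>
      rw [cocycle_tmul, cocycle_tmul, modExactClass_swap, LieModule.traceForm_comm, smul_neg]

theorem cocycle_self [CharZero k] (a : A ⊗[k] g) : cocycle k A g a a = 0 := by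
  have h : (2 : k) • cocycle k A g a a = 0 := by
    rw [two_smul]
    exact add_eq_zero_iff_eq_neg.mpr (cocycle_swap a a)
  exact (smul_eq_zero.mp h).resolve_left two_ne_zero

theorem cocycle_leibniz (a b c : A ⊗[k] g) :
    cocycle k A g a ⁅b, c⁆ = cocycle k A g ⁅a, b⁆ c + cocycle k A g b ⁅a, c⁆ := by
  induction a with
  | zero => simp
  | add a a' ha ha' =>
    simp only [map_add, LinearMap.add_apply, add_lie, ha, ha']; abel
  | tmul f x =>
    induction b with
    | zero => simp
    | add b b' hb hb' =>
      simp only [map_add, LinearMap.add_apply, add_lie, lie_add, hb, hb']; abel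
    | tmul h y =>
      induction c with
      | zero => simp
      | add c c' hc hc' =>
        simp only [map_add, lie_add, hc, hc']; abel
      | tmul q z =>
        simp only [LieAlgebra.ExtendScalars.bracket_tmul, cocycle_tmul]
        have h₁ := LieModule.traceForm_apply_lie_apply k g g x y z
        have h₂ := LieModule.traceForm_apply_lie_apply' k g g x y z
        have h₃ : modExactClass k A (f * h) q =
            -(modExactClass k A (q * f) h + modExactClass k A (q * h) f) := by
          rw [modExactClass_swap, modExactClass_mul_right]
        rw [modExactClass_mul_right, modExactClass_mul_right h, ← h₁, ← neg_eq_iff_eq_neg.mpr h₂,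
          h₃, mul_comm f q, mul_comm h f, mul_comm h q, h₃]
        module

variable (k A g) in
/-- The central extension of `A ⊗ g` by the differentials modulo exact forms defined by the
cocycle `(x, y) f dh`. -/
def Extension : Type _ := (A ⊗[k] g) × ModExact k A

namespace Extension

instance : AddCommGroup (Extension k A g) :=
  inferInstanceAs (AddCommGroup ((A ⊗[k] g) × ModExact k A))

instance : Module k (Extension k A g) :=
  inferInstanceAs (Module k ((A ⊗[k] g) × ModExact k A))

variable (k A g) in
/-- The identity of the underlying vector spaces. -/
def ofProd : ((A ⊗[k] g) × ModExact k A) ≃ₗ[k] Extension k A g := LinearEquiv.refl k _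

variable [CharZero k]

instance : LieRing (Extension k A g) where
  bracket v w := ofProd k A g (⁅((ofProd k A g).symm v).1, ((ofProd k A g).symm w).1⁆,
    cocycle k A g ((ofProd k A g).symm v).1 ((ofProd k A g).symm w).1)
  add_lie v v' w := by rw [← map_add]; congr 1; simp
  lie_add v w w' := by rw [← map_add]; congr 1; simp
  lie_self v := by
    rw [lie_self, cocycle_self]; rfl
  leibniz_lie v w z := by
    rw [← map_add]; congr 1
    simp only [LinearEquiv.symm_apply_apply]
    exact Prod.ext (leibniz_lie _ _ _) (cocycle_leibniz _ _ _)

theorem lie_ofProd (v w : (A ⊗[k] g) × ModExact k A) :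
    ⁅ofProd k A g v, ofProd k A g w⁆ = ofProd k A g (⁅v.1, w.1⁆, cocycle k A g v.1 w.1) := rfl

instance : LieAlgebra k (Extension k A g) where
  lie_smul c v w := by
    obtain ⟨v, rfl⟩ := (ofProd k A g).surjective v
    obtain ⟨w, rfl⟩ := (ofProd k A g).surjective w
    rw [← map_smul, lie_ofProd, lie_ofProd, ← map_smul]
    congr 1
    simp

variable (k A g) in
/-- The projection of the central extension onto `A ⊗ g`. -/
def proj : Extension k A g →ₗ⁅k⁆ A ⊗[k] g :=
  { LinearMap.fst k (A ⊗[k] g) (ModExact k A) ∘ₗ (ofProd k A g).symm.toLinearMap with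
    map_lie' := rfl }

theorem proj_ofProd (v : (A ⊗[k] g) × ModExact k A) : proj k A g (ofProd k A g v) = v.1 := rfl

theorem lie_ofProd_zero_left (c : ModExact k A) (v : Extension k A g) :
    ⁅ofProd k A g (0, c), v⁆ = 0 := by
  obtain ⟨v, rfl⟩ := (ofProd k A g).surjective v
  rw [lie_ofProd]
  simp

theorem isCentralExtension_proj : IsCentralExtension (proj k A g) := by
  refine ⟨fun a => ⟨ofProd k A g (a, 0), rfl⟩, fun z hz v => ?_⟩
  obtain ⟨⟨a, c⟩, rfl⟩ := (ofProd k A g).surjective z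
  obtain rfl : a = 0 := hz
  exact lie_ofProd_zero_left c v

/-- The extension is perfect: `f ⊗ ⁅x, y⁆` is the bracket of `f ⊗ x` and `1 ⊗ y` because `d1 = 0`,
and the classes `f dh` are differences of such elements and of brackets. -/
theorem linearMap_ext_of_lie [FiniteDimensional k g] [LieAlgebra.IsSimple k g] {W : Type*}
    [AddCommGroup W] [Module k W] {φ φ' : Extension k A g →ₗ[k] W} 
    (h : ∀ v w : Extension k A g, φ ⁅v, w⁆ = φ' ⁅v, w⁆) : φ = φ' := by
  have h₁ (a : A ⊗[k] g) : φ (ofProd k A g (a, 0)) = φ' (ofProd k A g (a, 0)) := by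
    have : φ ∘ₗ (ofProd k A g).toLinearMap ∘ₗ LinearMap.inl k _ _ =
        φ' ∘ₗ (ofProd k A g).toLinearMap ∘ₗ LinearMap.inl k _ _ := by
      refine TensorProduct.ext' fun f x => ?_
      have hx : x ∈ Submodule.span k {z : g | ∃ x y : g, ⁅x, y⁆ = z} := by
        rw [LieAlgebra.span_lie_eq_top]; trivial
      induction hx using Submodule.span_induction with
      | mem z hz =>
        obtain ⟨x, y, rfl⟩ := hz
        have := h (ofProd k A g (f ⊗ₜ x, 0)) (ofProd k A g (1 ⊗ₜ y, 0))
        simpa [lie_ofProd, cocycle_tmul, modExactClass_one_right] using this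
      | zero => simp only [TensorProduct.tmul_zero, map_zero]
      | add x y _ _ hx hy => rw [TensorProduct.tmul_add, map_add, map_add, hx, hy]
      | smul c x _ hx => rw [TensorProduct.tmul_smul, map_smul, map_smul, hx]
    exact congrArg (fun F => F a) this
  have h₂ : φ ∘ₗ (ofProd k A g).toLinearMap ∘ₗ LinearMap.inr k _ _ =
      φ' ∘ₗ (ofProd k A g).toLinearMap ∘ₗ LinearMap.inr k _ _ := by
    refine modExact_ext fun f q => ?_
    obtain ⟨x₁, x₂, y, hxy⟩ := LieAlgebra.exists_killingForm_lie_eq_one (k := k) (g := g)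
    have h₃ := h (ofProd k A g (f ⊗ₜ ⁅x₁, x₂⁆, 0)) (ofProd k A g (q ⊗ₜ y, 0))
    have h₄ (a : A ⊗[k] g) (c : ModExact k A) :
        ofProd k A g (a, c) = ofProd k A g (a, 0) + ofProd k A g (0, c) := by
      rw [← map_add]; simp
    rw [lie_ofProd, cocycle_tmul, hxy, one_smul, h₄, map_add, map_add, h₁] at h₃
    exact add_left_cancel h₃
  ext v
  obtain ⟨⟨a, c⟩, rfl⟩ := (ofProd k A g).surjective v
  have h₄ : ofProd k A g (a, c) = ofProd k A g (a, 0) + ofProd k A g (0, c) := by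
    rw [← map_add]; simp
  rw [h₄, map_add, map_add, h₁]
  exact congrArg _ (congrArg (fun F => F c) h₂)

end Extension

section CentralBracket

variable {M E : Type*} [LieRing M] [LieAlgebra k M] [LieRing E] [LieAlgebra k E]

variable (k M) in
/-- The Lie bracket as a bilinear map. -/
def lieBilin : M →ₗ[k] M →ₗ[k] M :=
  LinearMap.mk₂ k (fun a b => ⁅a, b⁆) add_lie smul_lie lie_add lie_smul

theorem lieBilin_apply (a b : M) : lieBilin k M a b = ⁅a, b⁆ := rfl

/-- For a linear section `s` of a central extension `E` of `M`, the bracket in `E` of lifts of two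
elements of `M`. -/
def centralBracket (s : M →ₗ[k] E) : M →ₗ[k] M →ₗ[k] E :=
  (lieBilin k E).compl₁₂ s s

theorem centralBracket_apply (s : M →ₗ[k] E) (a b : M) : centralBracket s a b = ⁅s a, s b⁆ := rfl

variable {ρ : E →ₗ⁅k⁆ M} (hρ : IsCentralExtension ρ) {s : M →ₗ[k] E} (hs : ∀ a, ρ (s a) = a)

include hρ hs

/-- The bracket in a central extension depends only on the images of its arguments. -/
theorem lie_eq_centralBracket (v w : E) : ⁅v, w⁆ = centralBracket s (ρ v) (ρ w) := by
  have h (v : E) : ρ (v - s (ρ v)) = 0 := by rw [map_sub, hs, sub_self]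
  have h₁ := hρ.2 _ (h v) w
  have h₂ := hρ.2 _ (h w) (s (ρ v))
  rw [sub_lie, sub_eq_zero] at h₁ h₂
  rw [centralBracket_apply, h₁, ← lie_skew, h₂, lie_skew]

theorem centralBracket_lie (a b c : M) : centralBracket s ⁅a, b⁆ c =
    centralBracket s a ⁅b, c⁆ - centralBracket s b ⁅a, c⁆ := by
  have h (a b : M) : ρ ⁅s a, s b⁆ = ⁅a, b⁆ := by rw [LieHom.map_lie, hs, hs]
  have h' := lie_lie (s a) (s b) (s c)
  rw [lie_eq_centralBracket hρ hs ⁅s a, s b⁆, lie_eq_centralBracket hρ hs (s a) ⁅s b, s c⁆,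
    lie_eq_centralBracket hρ hs (s b) ⁅s a, s c⁆] at h'
  simpa only [h, hs] using h'

end CentralBracket

section Universal

variable [CharZero k] [FiniteDimensional k g] [LieAlgebra.IsSimple k g]

open LieAlgebra (killingDualBasis)

theorem sum_tmul_lie_lie_dualBasis (a : A ⊗[k] g) :
    ∑ i, ⁅(1 : A) ⊗ₜ[k] Module.finBasis k g i,
      ⁅(1 : A) ⊗ₜ[k] killingDualBasis (Module.finBasis k g) i, a⁆⁆ = a := by
  induction a with
  | zero => simp
  | add a b ha hb => simp only [lie_add, Finset.sum_add_distrib, ha, hb]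
  | tmul f x =>
    simp only [LieAlgebra.ExtendScalars.bracket_tmul, one_mul]
    rw [← TensorProduct.tmul_sum, LieAlgebra.sum_lie_lie_dualBasis]

variable {E : Type*} [LieRing E] [LieAlgebra k E]

/-- The map `a ↦ ∑ F (bᵢ, ⁅bⁱ, a⁆)` for dual bases of `g` inside `A ⊗ g`. For `F` the bracket of
lifts to a central extension, this is a `g`-equivariant linear section, independent of choices. -/
def casimirSection (F : A ⊗[k] g →ₗ[k] A ⊗[k] g →ₗ[k] E) : A ⊗[k] g →ₗ[k] E :=
  ∑ i, F (1 ⊗ₜ Module.finBasis k g i) ∘ₗ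
    (lieBilin k (A ⊗[k] g)
      (1 ⊗ₜ killingDualBasis (Module.finBasis k g) i))

theorem casimirSection_apply (F : A ⊗[k] g →ₗ[k] A ⊗[k] g →ₗ[k] E) (a : A ⊗[k] g) :
    casimirSection F a = ∑ i, F (1 ⊗ₜ Module.finBasis k g i)
      ⁅(1 : A) ⊗ₜ[k] killingDualBasis (Module.finBasis k g) i, a⁆ := by
  simp [casimirSection, lieBilin_apply]

/-- By invariance of `∑ bᵢ ⊗ bⁱ`, moving `z` out of `⁅bⁱ, ⁅z, a⁆⁆` leaves `F z` applied to the
Casimir element acting on `a`. -/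
theorem casimirSection_lie (F : A ⊗[k] g →ₗ[k] A ⊗[k] g →ₗ[k] E)
    (hF : ∀ a b c : A ⊗[k] g, F ⁅a, b⁆ c = F a ⁅b, c⁆ - F b ⁅a, c⁆) (z : g) (a : A ⊗[k] g) :
    casimirSection F ⁅(1 : A) ⊗ₜ[k] z, a⁆ = F (1 ⊗ₜ z) a := by
  let ι : g →ₗ[k] A ⊗[k] g := TensorProduct.mk k A g 1
  have hι (x y : g) : (1 : A) ⊗ₜ[k] ⁅x, y⁆ = ⁅(1 : A) ⊗ₜ[k] x, (1 : A) ⊗ₜ[k] y⁆ := by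
    rw [LieAlgebra.ExtendScalars.bracket_tmul, one_mul]
  have key := LieAlgebra.sum_dualBasis_lie_invariant (Module.finBasis k g)
    (F.compl₁₂ ι ((lieBilin k (A ⊗[k] g)).flip a ∘ₗ ι)) z
  simp only [LinearMap.compl₁₂_apply, LinearMap.comp_apply, ι, TensorProduct.mk_apply,
    LinearMap.flip_apply, lieBilin_apply, hι] at key
  rw [casimirSection_apply]
  simp_rw [leibniz_lie _ ((1 : A) ⊗ₜ[k] z) a, map_add]
  rw [Finset.sum_add_distrib, key, ← Finset.sum_add_distrib]
  simp_rw [hF, sub_add_cancel]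
  rw [← map_sum, sum_tmul_lie_lie_dualBasis]

variable [IsAlgClosed k]

/-- A `g`-invariant two-cocycle on `A ⊗ g` is induced by the cocycle `(x, y) f dh`. -/
theorem exists_eq_comp_cocycle (τ : A ⊗[k] g →ₗ[k] A ⊗[k] g →ₗ[k] E)
    (hskew : ∀ a b, τ a b = -τ b a)
    (hτ : ∀ a b c : A ⊗[k] g, τ ⁅a, b⁆ c = τ a ⁅b, c⁆ - τ b ⁅a, c⁆)
    (h1 : ∀ z a, τ (1 ⊗ₜ z) a = 0) :
    ∃ θ : ModExact k A →ₗ[k] E, ∀ a b, θ (cocycle k A g a b) = τ a b := by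
  obtain ⟨x, y, z, hxyz⟩ := LieAlgebra.exists_killingForm_lie_eq_one (k := k) (g := g)
  let β (f h : A) : g →ₗ[k] g →ₗ[k] E :=
    τ.compl₁₂ (TensorProduct.mk k A g f) (TensorProduct.mk k A g h)
  let φ : A →ₗ[k] A →ₗ[k] E :=
    τ.compl₁₂ ((TensorProduct.mk k A g).flip ⁅x, y⁆) ((TensorProduct.mk k A g).flip z)
  have hφ (f h : A) (x' y' : g) : τ (f ⊗ₜ x') (h ⊗ₜ y') = killingForm k g x' y' • φ f h := by
    refine LieAlgebra.invariant_eq_killingForm_smul (β f h) (fun w x' y' => ?_) hxyz x' y'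
    have := hτ (1 ⊗ₜ w) (f ⊗ₜ x') (h ⊗ₜ y')
    rw [h1, zero_sub, LieAlgebra.ExtendScalars.bracket_tmul,
      LieAlgebra.ExtendScalars.bracket_tmul, one_mul, one_mul] at this
    exact this
  have hφskew (f h : A) : φ f h = -φ h f := by
    have := hskew (f ⊗ₜ ⁅x, y⁆) (h ⊗ₜ z)
    rwa [hφ, hφ, LieModule.traceForm_comm k g g z, hxyz, one_smul, one_smul] at this
  have hφmul (f h q : A) : φ f (h * q) = φ (f * h) q + φ (f * q) h := by
    have := hτ (f ⊗ₜ x) (h ⊗ₜ y) (q ⊗ₜ z)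
    simp only [LieAlgebra.ExtendScalars.bracket_tmul, hφ] at this
    rw [← neg_eq_iff_eq_neg.mpr (LieModule.traceForm_apply_lie_apply' k g g x y z),
      ← LieModule.traceForm_apply_lie_apply, hxyz, one_smul, one_smul, hφskew h] at this
    rw [this]
    module
  have hφ1 (h : A) : φ 1 h = 0 := h1 _ _
  refine ⟨modExactLift φ hφmul hφ1, fun a b => ?_⟩
  induction a with
  | zero => simp
  | add a a' ha ha' => simp only [map_add, LinearMap.add_apply, ha, ha']
  | tmul f x' =>
    induction b with
    | zero => simp
    | add b b' hb hb' => simp only [map_add, hb, hb']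
    | tmul h y' => rw [cocycle_tmul, map_smul, modExactLift_apply, hφ]

theorem exists_lift {ρ : E →ₗ⁅k⁆ A ⊗[k] g} (hρ : IsCentralExtension ρ) :
    ∃ φ : Extension k A g →ₗ⁅k⁆ E, ρ.comp φ = Extension.proj k A g := by
  obtain ⟨s, hs⟩ := LinearMap.exists_rightInverse_of_surjective (ρ : E →ₗ[k] A ⊗[k] g)
    (LinearMap.range_eq_top.mpr hρ.1)
  replace hs (a : A ⊗[k] g) : ρ (s a) = a := congrArg (fun F => F a) hs
  have hF := centralBracket_lie hρ hs
  have hρF (a b : A ⊗[k] g) : ρ (centralBracket s a b) = ⁅a, b⁆ := by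
    rw [centralBracket_apply, LieHom.map_lie, hs, hs]
  set ψ := casimirSection (centralBracket s) with hψ
  have hρψ (a : A ⊗[k] g) : ρ (ψ a) = a := by
    rw [hψ, casimirSection_apply, map_sum]
    simp_rw [hρF]
    exact sum_tmul_lie_lie_dualBasis a
  -- the defect of `ψ` is an invariant cocycle
  let τ : A ⊗[k] g →ₗ[k] A ⊗[k] g →ₗ[k] E := centralBracket s -
    (lieBilin k (A ⊗[k] g)).compr₂ ψ
  have hτ (a b : A ⊗[k] g) : τ a b = centralBracket s a b - ψ ⁅a, b⁆ := rfl
  obtain ⟨θ, hθ⟩ := exists_eq_comp_cocycle τ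
    (fun a b => by
      rw [hτ, hτ, centralBracket_apply, centralBracket_apply, ← lie_skew, ← lie_skew a b, map_neg]
      abel)
    (fun a b c => by
      rw [hτ, hτ, hτ, hF, lie_lie, map_sub]
      abel)
    (fun z a => by rw [hτ, hψ, casimirSection_lie _ hF, sub_self])
  have hρθ (c : ModExact k A) : ρ (θ c) = 0 := by
    obtain ⟨x, y, z, hxyz⟩ := LieAlgebra.exists_killingForm_lie_eq_one (k := k) (g := g)
    have : (ρ : E →ₗ[k] A ⊗[k] g) ∘ₗ θ = 0 := modExact_ext fun f h => by
      have := hθ (f ⊗ₜ ⁅x, y⁆) (h ⊗ₜ z)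
      rw [cocycle_tmul, hxyz, one_smul] at this
      rw [LinearMap.comp_apply, this, hτ, LieHom.coe_toLinearMap, map_sub, hρF, hρψ, sub_self,
        LinearMap.zero_apply]
    exact congrArg (fun F => F c) this
  let Φ : Extension k A g →ₗ[k] E :=
    (ψ.coprod θ) ∘ₗ (Extension.ofProd k A g).symm.toLinearMap
  have hΦ (v : (A ⊗[k] g) × ModExact k A) : Φ (Extension.ofProd k A g v) = ψ v.1 + θ v.2 := rfl
  have hρΦ (v : Extension k A g) : ρ (Φ v) = Extension.proj k A g v := by
    obtain ⟨v, rfl⟩ := (Extension.ofProd k A g).surjective v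
    rw [hΦ, map_add, hρψ, hρθ, add_zero, Extension.proj_ofProd]
  refine ⟨{ Φ with map_lie' := fun {v w} => ?_ }, LieHom.ext hρΦ⟩
  change Φ ⁅v, w⁆ = ⁅Φ v, Φ w⁆
  rw [lie_eq_centralBracket hρ hs, hρΦ, hρΦ]
  obtain ⟨v, rfl⟩ := (Extension.ofProd k A g).surjective v
  obtain ⟨w, rfl⟩ := (Extension.ofProd k A g).surjective w
  rw [Extension.lie_ofProd, hΦ, hθ, hτ, add_sub_cancel, Extension.proj_ofProd,
    Extension.proj_ofProd]

variable (k A g) in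
/-- **Kassel's theorem**: for a simple Lie algebra `g`, the universal central extension of `A ⊗ g`
has kernel the Kähler differentials of `A` modulo exact forms. -/
theorem isUniversalCentralExtension_proj :
    IsUniversalCentralExtension.{w} (Extension.proj k A g) := by
  refine ⟨Extension.isCentralExtension_proj, fun E _ _ ρ hρ => ?_⟩
  obtain ⟨φ, hφ⟩ := exists_lift hρ
  refine ⟨φ, hφ, fun φ' hφ' => ?_⟩
  have h (v : Extension k A g) : ρ (φ' v - φ v) = 0 := by
    have := congrArg (fun F : Extension k A g →ₗ⁅k⁆ A ⊗[k] g => F v) (hφ'.trans hφ.symm)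
    rw [map_sub, sub_eq_zero]
    exact this
  have h' : (φ' : Extension k A g →ₗ[k] E) = φ := Extension.linearMap_ext_of_lie fun v w => by
    have h₁ := hρ.2 _ (h v) (φ' w)
    have h₂ := hρ.2 _ (h w) (φ v)
    rw [sub_lie, sub_eq_zero] at h₁ h₂
    simp only [LieHom.coe_toLinearMap, LieHom.map_lie]
    rw [h₁, ← lie_skew, h₂, lie_skew]
  exact LieHom.ext fun v => congrArg (fun F => F v) h'

end Universal

end CurrentAlgebra

/-! ### The recurrence solved by `P` and `Q` -/

namespace Hyperelliptic

open KaehlerDifferential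

section Sequences

variable {n : ℕ} {a : ℕ → ℂ}

/-- A sequence satisfying the recurrence of the classes `t ^ k u dt` is determined, for `k ≥ -n`,
by its values at `-1, …, -n`. -/
theorem eq_sum_P_smul {W : Type*} [AddCommGroup W] [Module ℂ W] (han : a n = 1) {c : ℤ → W}
    (hc : ∀ m : ℤ, ∑ j ∈ Finset.range (n + 1), ((2 * (m : ℂ) + 3 * j) * a j) • c (m - 1 + j) = 0)
    (k : ℤ) (hk : -(n : ℤ) ≤ k) :
    c k = ∑ l ∈ Finset.Icc 1 n, P n a k (-(l : ℤ)) • c (-(l : ℤ)) := by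
  induction h : (k + n).toNat using Nat.strong_induction_on generalizing k with
  | _ d ih =>
  subst h
  rcases lt_or_ge k 0 with hk0 | hk0
  · rw [Finset.sum_eq_single (-k).toNat]
    · rw [P_init _ _ _ _ (by omega), if_pos (by omega), one_smul]; congr 1; omega
    · intro l _ hl
      rw [P_init _ _ _ _ (by omega), if_neg (by omega), zero_smul]
    · intro h; exact absurd (Finset.mem_Icc.mpr (by omega)) h
  · have hne : (2 * (k : ℂ) + n + 2) ≠ 0 := by
      have : (2 * k + n + 2 : ℤ) ≠ 0 := by omega
      exact_mod_cast this
    -- the relation whose term of highest index is `c k`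
    have h := hc (k - n + 1)
    rw [Finset.sum_range_succ, han, add_comm] at h
    have h' := eq_neg_of_add_eq_zero_left h
    refine smul_right_injective W hne ?_
    dsimp only
    rw [Finset.smul_sum]
    simp_rw [smul_smul, P_rec n a k _ hk0]
    have e₁ : (2 * (k : ℂ) + n + 2) • c k =
        ((2 * ((k - n + 1 : ℤ) : ℂ) + 3 * n) * 1) • c (k - n + 1 - 1 + n) := by
      congr 1
      · push_cast; ring
      · congr 1; ring
    rw [e₁, h', ← Finset.sum_neg_distrib]
    simp_rw [neg_smul, Finset.sum_smul, ← Finset.sum_neg_distrib]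
    rw [Finset.sum_comm]
    refine Finset.sum_congr rfl fun j hj => ?_
    rw [Finset.mem_range] at hj
    rw [show k - n + 1 - 1 + (j : ℤ) = k - n + j by ring,
      ih _ (by omega) (k - n + j) (by omega) rfl, Finset.sum_neg_distrib, Finset.smul_sum]
    congr 1
    refine Finset.sum_congr rfl fun l _ => ?_
    rw [smul_smul]
    congr 1
    push_cast; ring

theorem sum_range_succ_eq_add_sum_Icc {W : Type*} [AddCommMonoid W] (f : ℕ → W) (n : ℕ) :
    ∑ j ∈ Finset.range (n + 1), f j = f 0 + ∑ j ∈ Finset.Icc 1 n, f j := by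
  rw [Finset.range_eq_Ico, Finset.sum_eq_sum_Ico_succ_bot (Nat.succ_pos n),
    Nat.succ_eq_add_one, Finset.Ico_add_one_right_eq_Icc]

/-- A sequence satisfying the recurrence of the classes `t ^ k u dt` is determined, for `k ≤ -1`,
by its values at `-1, …, -n`. -/
theorem eq_sum_Q_smul {W : Type*} [AddCommGroup W] [Module ℂ W] (hn : 1 ≤ n) (ha0 : a 0 ≠ 0)
    {c : ℤ → W}
    (hc : ∀ m : ℤ, ∑ j ∈ Finset.range (n + 1), ((2 * (m : ℂ) + 3 * j) * a j) • c (m - 1 + j) = 0)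
    (m : ℤ) (hm : 1 ≤ m) :
    c (-m) = ∑ l ∈ Finset.Icc 1 n, Q n a m (-(l : ℤ)) • c (-(l : ℤ)) := by
  induction h : m.toNat using Nat.strong_induction_on generalizing m with
  | _ d ih =>
  subst h
  rcases le_or_gt m n with hmn | hmn
  · rw [Finset.sum_eq_single m.toNat]
    · rw [Q_init _ _ _ _ (by omega), if_pos (by omega), one_smul]; congr 1; omega
    · intro l _ hl
      rw [Q_init _ _ _ _ (by omega), if_neg (by omega), zero_smul]
    · intro h; exact absurd (Finset.mem_Icc.mpr (by omega)) h
  · have hne : -2 * ((m : ℂ) - 1) * a 0 ≠ 0 := by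
      have : (m - 1 : ℤ) ≠ 0 := by omega
      have : ((m : ℂ) - 1) ≠ 0 := by exact_mod_cast this
      exact mul_ne_zero (mul_ne_zero (by norm_num) this) ha0
    -- the relation whose term of lowest index is `c (-m)`
    have h := hc (1 - m)
    rw [sum_range_succ_eq_add_sum_Icc] at h
    have h' := eq_neg_of_add_eq_zero_left h
    refine smul_right_injective W hne ?_
    dsimp only
    rw [Finset.smul_sum]
    simp_rw [smul_smul, Q_rec n a ha0 hn m _ hmn]
    have e₁ : (-2 * ((m : ℂ) - 1) * a 0) • c (-m) =
        ((2 * ((1 - m : ℤ) : ℂ) + 3 * (0 : ℕ)) * a 0) • c (1 - m - 1 + (0 : ℕ)) := by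
      congr 1
      · push_cast; ring
      · congr 1; push_cast; ring
    rw [e₁, h', ← Finset.sum_neg_distrib]
    simp_rw [neg_smul, Finset.sum_smul, ← Finset.sum_neg_distrib]
    rw [Finset.sum_comm]
    refine Finset.sum_congr rfl fun j hj => ?_
    rw [Finset.mem_Icc] at hj
    rw [show 1 - m - 1 + (j : ℤ) = -(m - j) by ring, ih _ (by omega) (m - j) (by omega) rfl,
      Finset.sum_neg_distrib, Finset.smul_sum]
    congr 1
    refine Finset.sum_congr rfl fun l _ => ?_
    rw [smul_smul]
    congr 1
    push_cast; ring

/-- The coefficient of `t ^ k u dt` at `t ^ (-l) u dt`. -/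
def oddCoeff (n : ℕ) (a : ℕ → ℂ) (l : ℕ) (k : ℤ) : ℂ :=
  if k < 0 then Q n a (-k) (-(l : ℤ)) else P n a k (-(l : ℤ))

theorem oddCoeff_of_neg (l : ℕ) {k : ℤ} (hk : k < 0) :
    oddCoeff n a l k = Q n a (-k) (-(l : ℤ)) := if_pos hk

theorem oddCoeff_of_ge (l : ℕ) {k : ℤ} (hk : -(n : ℤ) ≤ k) :
    oddCoeff n a l k = P n a k (-(l : ℤ)) := by
  rcases lt_or_ge k 0 with h | h
  · rw [oddCoeff_of_neg l h, P_init _ _ _ _ (by omega), Q_init _ _ _ _ (by omega)]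
    exact if_congr (by omega) rfl rfl
  · exact if_neg (by omega)

theorem oddCoeff_neg (l : ℕ) {m : ℕ} (hm : m ∈ Finset.Icc 1 n) :
    oddCoeff n a l (-(m : ℤ)) = if l = m then 1 else 0 := by
  rw [Finset.mem_Icc] at hm
  rw [oddCoeff_of_neg l (by omega), Q_init _ _ _ _ (by omega)]
  exact if_congr (by omega) rfl rfl

theorem sum_oddCoeff_eq_zero (hn : 1 ≤ n) (ha0 : a 0 ≠ 0) (han : a n = 1) (l : ℕ) (m : ℤ) :
    ∑ j ∈ Finset.range (n + 1),
      ((2 * (m : ℂ) + 3 * j) * a j) * oddCoeff n a l (m - 1 + j) = 0 := by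
  rcases lt_or_ge m (1 - n) with h | h
  · have hQ := Q_rec n a ha0 hn (1 - m) (-(l : ℤ)) (by omega)
    rw [sum_range_succ_eq_add_sum_Icc, oddCoeff_of_neg l (by omega)]
    have e₁ : ∑ j ∈ Finset.Icc 1 n, ((2 * (m : ℂ) + 3 * j) * a j) * oddCoeff n a l (m - 1 + j) =
        ∑ j ∈ Finset.Icc 1 n, (3 * (j : ℂ) - 2 * ((1 - m : ℤ) : ℂ) + 2) * a j *
          Q n a (1 - m - j) (-(l : ℤ)) := by
      refine Finset.sum_congr rfl fun j hj => ?_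
      rw [Finset.mem_Icc] at hj
      rw [oddCoeff_of_neg l (by omega), show -(m - 1 + (j : ℤ)) = 1 - m - j by ring]
      push_cast; ring
    rw [e₁, ← neg_neg (∑ j ∈ _, _), ← hQ, show -(m - 1 + ((0 : ℕ) : ℤ)) = 1 - m by push_cast; ring]
    push_cast; ring
  · have hP := P_rec n a (m + n - 1) (-(l : ℤ)) (by omega)
    rw [Finset.sum_range_succ, oddCoeff_of_ge l (by omega), han]
    have e₁ : ∑ j ∈ Finset.range n, ((2 * (m : ℂ) + 3 * j) * a j) * oddCoeff n a l (m - 1 + j) =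
        ∑ j ∈ Finset.range n, (3 * (j : ℂ) + 2 * ((m + n - 1 : ℤ) : ℂ) - 2 * (n : ℂ) + 2) * a j *
          P n a (m + n - 1 - n + j) (-(l : ℤ)) := by
      refine Finset.sum_congr rfl fun j hj => ?_
      rw [oddCoeff_of_ge l (by omega), show m + n - 1 - n + (j : ℤ) = m - 1 + j by ring]
      push_cast; ring
    rw [e₁, ← neg_neg (∑ j ∈ _, _), ← hP, show m - 1 + (n : ℤ) = m + n - 1 by ring]
    push_cast; ring

end Sequences

end Hyperelliptic

/-! ### Laurent polynomials, coordinates on `R`, and functionals on differentials -/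

namespace LaurentPolynomial

variable {V : Type*} [AddCommGroup V] [Module ℂ V]

/-- The linear map on Laurent polynomials with prescribed values on the monomials. -/
def ofValues (c : ℤ → V) : ℂ[T;T⁻¹] →ₗ[ℂ] V :=
  Finsupp.linearCombination ℂ c ∘ₗ (AddMonoidAlgebra.coeffLinearEquiv ℂ).toLinearMap

@[simp]
theorem ofValues_T (c : ℤ → V) (i : ℤ) : ofValues c (T i) = c i := by
  have : (AddMonoidAlgebra.coeffLinearEquiv ℂ (T i : ℂ[T;T⁻¹])) = Finsupp.single i 1 := rfl
  simp [ofValues, this]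

theorem linearMap_ext_T {F G : ℂ[T;T⁻¹] →ₗ[ℂ] V} (h : ∀ i, F (T i) = G (T i)) : F = G := by
  refine AddMonoidAlgebra.lhom_ext' fun i => LinearMap.ext_ring ?_
  exact h i

theorem span_range_T : Submodule.span ℂ (Set.range (T : ℤ → ℂ[T;T⁻¹])) = ⊤ := by
  rw [← Submodule.ker_mkQ (Submodule.span ℂ (Set.range (T : ℤ → ℂ[T;T⁻¹])))]
  refine LinearMap.ker_eq_top.mpr (linearMap_ext_T fun i => ?_)
  rw [Submodule.mkQ_apply, LinearMap.zero_apply, Submodule.Quotient.mk_eq_zero]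
  exact Submodule.subset_span ⟨i, rfl⟩

/-- The derivative `d/dt` of Laurent polynomials. -/
def deriv : ℂ[T;T⁻¹] →ₗ[ℂ] ℂ[T;T⁻¹] := ofValues fun i => (i : ℂ) • T (i - 1)

@[simp]
theorem deriv_T (i : ℤ) : deriv (T i) = (i : ℂ) • T (i - 1) := ofValues_T _ _

theorem deriv_mul (f g : ℂ[T;T⁻¹]) : deriv (f * g) = f * deriv g + g * deriv f := by
  have : (LinearMap.mul ℂ ℂ[T;T⁻¹]).compr₂ deriv =
      (LinearMap.mul ℂ ℂ[T;T⁻¹]).compl₁₂ LinearMap.id deriv +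
        ((LinearMap.mul ℂ ℂ[T;T⁻¹]).compl₁₂ LinearMap.id deriv).flip := by
    refine linearMap_ext_T fun i => linearMap_ext_T fun j => ?_
    simp only [LinearMap.compr₂_apply, LinearMap.mul_apply', LinearMap.add_apply,
      LinearMap.compl₁₂_apply, LinearMap.flip_apply, LinearMap.id_apply, deriv_T, ← T_add,
      mul_smul_comm]
    rw [show i + (j - 1) = i + j - 1 by ring, show j + (i - 1) = i + j - 1 by ring, ← add_smul]
    push_cast
    rw [add_comm]
  exact congrArg (fun F => F f g) this

end LaurentPolynomial

namespace Hyperelliptic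

open KaehlerDifferential LaurentPolynomial

variable (p : ℂ[X])

theorem monic_defining :
    (Polynomial.X ^ 2 - Polynomial.C (Polynomial.toLaurent p) : ℂ[T;T⁻¹][X]).Monic :=
  Polynomial.monic_X_pow_sub_C _ two_ne_zero

/-- The coordinate of index `i` with respect to the basis `1, u` of `R` over `ℂ[t, t⁻¹]`. -/
def coord (i : ℕ) : CoordRing p →ₗ[ℂ] ℂ[T;T⁻¹] :=
  ((Polynomial.lcoeff ℂ[T;T⁻¹] i) ∘ₗ AdjoinRoot.modByMonicHom (monic_defining p)).restrictScalars ℂ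

theorem ofLaurent_eq_of (a : ℂ[T;T⁻¹]) : ofLaurent p a = AdjoinRoot.of _ a := rfl

theorem u_mul_u : u p * u p = pt p := by
  have h : AdjoinRoot.mk (Polynomial.X ^ 2 - Polynomial.C (Polynomial.toLaurent p) : ℂ[T;T⁻¹][X])
      (Polynomial.X ^ 2 - Polynomial.C (Polynomial.toLaurent p)) = 0 := AdjoinRoot.mk_self
  rw [map_sub, map_pow, AdjoinRoot.mk_X, AdjoinRoot.mk_C, sub_eq_zero] at h
  rw [pt, ofLaurent_eq_of, u, ← sq, h]

theorem coord_eq (a b : ℂ[T;T⁻¹]) (i : ℕ) :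
    coord p i (ofLaurent p a + ofLaurent p b * u p) =
      (Polynomial.C a + Polynomial.C b * Polynomial.X).coeff i := by
  have h : ofLaurent p a + ofLaurent p b * u p =
      AdjoinRoot.mk _ (Polynomial.C a + Polynomial.C b * Polynomial.X) := by
    rw [map_add, map_mul, AdjoinRoot.mk_X, AdjoinRoot.mk_C, AdjoinRoot.mk_C,
      ofLaurent_eq_of, ofLaurent_eq_of, u]
  have hd : (Polynomial.C a + Polynomial.C b * Polynomial.X).degree <
      (Polynomial.X ^ 2 - Polynomial.C (Polynomial.toLaurent p) : ℂ[T;T⁻¹][X]).degree := by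
    rw [Polynomial.degree_X_pow_sub_C two_pos, add_comm]
    exact Polynomial.degree_linear_lt
  rw [h]
  change (AdjoinRoot.modByMonicHom (monic_defining p) _).coeff i = _
  rw [AdjoinRoot.modByMonicHom_mk, (Polynomial.modByMonic_eq_self_iff (monic_defining p)).mpr hd]

theorem coord_zero_eq (a b : ℂ[T;T⁻¹]) :
    coord p 0 (ofLaurent p a + ofLaurent p b * u p) = a := by
  rw [coord_eq]; simp

theorem coord_one_eq (a b : ℂ[T;T⁻¹]) :
    coord p 1 (ofLaurent p a + ofLaurent p b * u p) = b := by
  rw [coord_eq]; simp [Polynomial.coeff_C]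

theorem exists_eq_add_mul_u (f : CoordRing p) :
    ∃ a b, f = ofLaurent p a + ofLaurent p b * u p := by
  obtain ⟨F, rfl⟩ := AdjoinRoot.mk_surjective f
  set G := F %ₘ (Polynomial.X ^ 2 - Polynomial.C (Polynomial.toLaurent p)) with hG
  have hF : AdjoinRoot.mk (Polynomial.X ^ 2 - Polynomial.C (Polynomial.toLaurent p)) F =
      AdjoinRoot.mk _ G := by
    conv_lhs => rw [← AdjoinRoot.mk_leftInverse (monic_defining p) (AdjoinRoot.mk _ F),
      AdjoinRoot.modByMonicHom_mk]
  have hd : G.degree < 2 := by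
    have := Polynomial.degree_modByMonic_lt F (monic_defining p)
    rwa [Polynomial.degree_X_pow_sub_C two_pos] at this
  have hd' : G.degree ≤ 1 := by
    exact Order.le_of_lt_succ hd
  refine ⟨G.coeff 0, G.coeff 1, ?_⟩
  rw [hF]
  conv_lhs => rw [Polynomial.eq_X_add_C_of_degree_le_one hd']
  rw [map_add, map_mul, AdjoinRoot.mk_X, AdjoinRoot.mk_C, AdjoinRoot.mk_C, add_comm,
    ofLaurent_eq_of, ofLaurent_eq_of, u]

theorem toLaurent_eq_sum : Polynomial.toLaurent p =
    ∑ j ∈ Finset.range (p.natDegree + 1), p.coeff j • (T (j : ℤ) : ℂ[T;T⁻¹]) := by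
  conv_lhs => rw [p.as_sum_range_C_mul_X_pow, map_sum]
  refine Finset.sum_congr rfl fun j _ => ?_
  rw [Polynomial.toLaurent_C_mul_X_pow, LaurentPolynomial.smul_eq_C_mul]

section Functional

variable {p} (r : ℂ) {c : ℤ → ℂ}

/-- The recurrence for `c`, as the vanishing of the functional `t ^ k ↦ c k` on
`2 (b p)' + b p'` for all Laurent polynomials `b`. -/
theorem ofValues_deriv_mul (hc : ∀ m : ℤ, ∑ j ∈ Finset.range (p.natDegree + 1),
      ((2 * (m : ℂ) + 3 * j) * p.coeff j) * c (m - 1 + j) = 0) (b : ℂ[T;T⁻¹]) :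
    2 * ofValues c (deriv (b * Polynomial.toLaurent p)) +
      ofValues c (b * deriv (Polynomial.toLaurent p)) = 0 := by
  have : (2 : ℂ) • (ofValues c ∘ₗ deriv ∘ₗ LinearMap.mulRight ℂ (Polynomial.toLaurent p)) +
      ofValues c ∘ₗ LinearMap.mulRight ℂ (deriv (Polynomial.toLaurent p)) = 0 := by
    refine linearMap_ext_T fun m => ?_
    simp only [LinearMap.add_apply, LinearMap.smul_apply, LinearMap.comp_apply,
      LinearMap.mulRight_apply, LinearMap.zero_apply, toLaurent_eq_sum, Finset.mul_sum, map_sum,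
      map_smul, mul_smul_comm, ← T_add, deriv_T, ofValues_T, smul_eq_mul]
    rw [← Finset.sum_add_distrib, ← hc m]
    refine Finset.sum_congr rfl fun j _ => ?_
    rw [show m + ((j : ℤ) - 1) = m - 1 + j by ring, show m + (j : ℤ) - 1 = m - 1 + j by ring]
    push_cast; ring
  simpa using congrArg (fun F => F b) this

/-- The functional on Laurent polynomials with value `r` at `t⁻¹` and `0` at the other
monomials. -/
def residue : ℂ[T;T⁻¹] →ₗ[ℂ] ℂ := ofValues fun i => if i = -1 then r else 0

theorem residue_deriv (f : ℂ[T;T⁻¹]) : residue r (deriv f) = 0 := by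
  have : residue r ∘ₗ deriv = 0 := linearMap_ext_T fun i => by
    rw [LinearMap.comp_apply, deriv_T, map_smul, residue, ofValues_T, LinearMap.zero_apply]
    split_ifs with h
    · obtain rfl : i = 0 := by omega
      simp
    · simp
  exact congrArg (fun F => F f) this

variable (p c) in
/-- The bilinear map sending `(a + b u, d + e u)` to the value on `(a + b u) d(d + e u)` of the
functional with `t ^ k dt ↦ r δ_{k,-1}` and `t ^ k u dt ↦ c k`, modulo exact forms. -/
def pairing : CoordRing p →ₗ[ℂ] CoordRing p →ₗ[ℂ] ℂ :=
  let μ (ψ : ℂ[T;T⁻¹] →ₗ[ℂ] ℂ) := (LinearMap.mul ℂ ℂ[T;T⁻¹]).compr₂ ψ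
  (μ (residue r)).compl₁₂ (coord p 0) (deriv ∘ₗ coord p 0) +
    (μ (residue r ∘ₗ LinearMap.mulRight ℂ (Polynomial.toLaurent p))).compl₁₂ (coord p 1)
      (deriv ∘ₗ coord p 1) +
    (1 / 2 : ℂ) • (μ (residue r ∘ₗ LinearMap.mulRight ℂ (deriv (Polynomial.toLaurent p)))).compl₁₂
      (coord p 1) (coord p 1) +
    (μ (ofValues c)).compl₁₂ (coord p 1) (deriv ∘ₗ coord p 0) -
    (μ (ofValues c)).compl₁₂ (deriv ∘ₗ coord p 0) (coord p 1)

theorem pairing_apply (f h : CoordRing p) : pairing p r c f h =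
    residue r (coord p 0 f * deriv (coord p 0 h)) +
      residue r (coord p 1 f * deriv (coord p 1 h) * Polynomial.toLaurent p) +
      1 / 2 * residue r (coord p 1 f * coord p 1 h * deriv (Polynomial.toLaurent p)) +
      ofValues c (coord p 1 f * deriv (coord p 0 h)) -
      ofValues c (deriv (coord p 0 f) * coord p 1 h) := rfl

theorem coord_mul (f h : CoordRing p) :
    coord p 0 (f * h) = coord p 0 f * coord p 0 h +
      coord p 1 f * coord p 1 h * Polynomial.toLaurent p ∧
    coord p 1 (f * h) = coord p 0 f * coord p 1 h + coord p 1 f * coord p 0 h := by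
  obtain ⟨a, b, rfl⟩ := exists_eq_add_mul_u p f
  obtain ⟨d, e, rfl⟩ := exists_eq_add_mul_u p h
  have : (ofLaurent p a + ofLaurent p b * u p) * (ofLaurent p d + ofLaurent p e * u p) =
      ofLaurent p (a * d + b * e * Polynomial.toLaurent p) + ofLaurent p (a * e + b * d) * u p := by
    have hu := u_mul_u p
    rw [pt] at hu
    simp only [map_add, map_mul]
    linear_combination (ofLaurent p b * ofLaurent p e) * hu
  rw [this]
  simp only [coord_zero_eq, coord_one_eq, and_self]

/-- The terms with residues satisfy the Leibniz rule identically. For the others its defect is the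
value on `2 (b p)' + b p'` of the functional `t ^ k ↦ c k`, with `b` the product of the coordinates
at `u` of `f`, `g` and `h`. -/
theorem pairing_mul (hc : ∀ m : ℤ, ∑ j ∈ Finset.range (p.natDegree + 1),
      ((2 * (m : ℂ) + 3 * j) * p.coeff j) * c (m - 1 + j) = 0) (f g h : CoordRing p) :
    pairing p r c f (g * h) = pairing p r c (f * g) h + pairing p r c (f * h) g := by
  simp only [pairing_apply, coord_mul]
  generalize coord p 0 f = a, coord p 1 f = b, coord p 0 g = a₁, coord p 1 g = b₁,
    coord p 0 h = a₂, coord p 1 h = b₂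
  have key := ofValues_deriv_mul hc (b * b₁ * b₂)
  simp only [deriv_mul, map_add, mul_add, add_mul] at key ⊢
  ring_nf at key ⊢
  linear_combination key

theorem coord_of (a : ℂ[T;T⁻¹]) :
    coord p 0 (ofLaurent p a) = a ∧ coord p 1 (ofLaurent p a) = 0 := by
  have h : ofLaurent p a = ofLaurent p a + ofLaurent p 0 * u p := by simp
  rw [h, coord_zero_eq, coord_one_eq]
  exact ⟨rfl, rfl⟩

theorem coord_of_mul_u (a : ℂ[T;T⁻¹]) :
    coord p 0 (ofLaurent p a * u p) = 0 ∧ coord p 1 (ofLaurent p a * u p) = a := by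
  have h : ofLaurent p a * u p = ofLaurent p 0 + ofLaurent p a * u p := by simp
  rw [h, coord_zero_eq, coord_one_eq]
  exact ⟨rfl, rfl⟩

theorem pairing_one (h : CoordRing p) : pairing p r c 1 h = 0 := by
  have h1 : (1 : CoordRing p) = ofLaurent p (T 0) := by rw [T_zero, map_one]
  rw [pairing_apply, h1, (coord_of _).1, (coord_of _).2]
  have hd : deriv (1 : ℂ[T;T⁻¹]) = 0 := by
    rw [← T_zero, deriv_T, Int.cast_zero, zero_smul]
  simp only [hd, T_zero, one_mul, zero_mul, map_zero, residue_deriv]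
  ring

variable (p) in
theorem formClass_eq (f h : CoordRing p) :
    formClass p f h = modExactClass ℂ (CoordRing p) f h := rfl

/-- The functional on differentials modulo exact forms with values `r` at `t⁻¹ dt` and `c k` at
`t ^ k u dt`. -/
theorem exists_functional (hc : ∀ m : ℤ, ∑ j ∈ Finset.range (p.natDegree + 1),
      ((2 * (m : ℂ) + 3 * j) * p.coeff j) * c (m - 1 + j) = 0) :
    ∃ θ : DifferentialsModExact p →ₗ[ℂ] ℂ, θ (formClass p (t p (-1)) (t p 1)) = r ∧
      ∀ k, θ (formClass p (t p k * u p) (t p 1)) = c k := by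
  refine ⟨modExactLift (pairing p r c) (pairing_mul r hc) (pairing_one r), ?_, fun k => ?_⟩
  · rw [formClass_eq, modExactLift_apply, pairing_apply]
    simp [t, coord_of, residue]
  · rw [formClass_eq, modExactLift_apply, pairing_apply]
    simp [t, coord_of, coord_of_mul_u]

end Functional

end Hyperelliptic

/-! ### Classes of differentials on the hyperelliptic curve -/

namespace Hyperelliptic

open KaehlerDifferential LaurentPolynomial

variable (p : ℂ[X])

theorem t_mul_t (i j : ℤ) : t p i * t p j = t p (i + j) := by
  rw [t, t, t, ← map_mul, T_add]

theorem t_zero : t p 0 = 1 := by rw [t, T_zero, map_one]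

theorem pt_eq_sum :
    pt p = ∑ j ∈ Finset.range (p.natDegree + 1), p.coeff j • t p (j : ℤ) := by
  have h := congrArg (ofLaurent p) (toLaurent_eq_sum p)
  rw [map_sum] at h
  simp only [map_smul] at h
  exact h

variable {p}

theorem formClass_mul_right (f g h : CoordRing p) :
    formClass p f (g * h) = formClass p (f * g) h + formClass p (f * h) g :=
  modExactClass_mul_right f g h

theorem formClass_t_right (f : CoordRing p) (j : ℤ) :
    formClass p f (t p j) = (j : ℂ) • formClass p (f * t p (j - 1)) (t p 1) := by
  induction j using Int.induction_on generalizing f with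
  | zero =>
    rw [t_zero, formClass_eq, modExactClass_one_right, Int.cast_zero, zero_smul]
  | succ i ih =>
    rw [← t_mul_t, formClass_mul_right, ih, mul_assoc, t_mul_t, add_sub_cancel_right,
      add_sub_cancel]
    push_cast
    module
  | pred i ih =>
    have h := formClass_mul_right (f * t p (-1)) (t p (-(i : ℤ) - 1)) (t p 1)
    rw [t_mul_t, sub_add_cancel, ih, mul_assoc, mul_assoc, t_mul_t, t_mul_t,
      neg_add_cancel, t_zero, mul_one] at h
    rw [← sub_eq_iff_eq_add'] at h
    rw [← h, show -1 + (-(i : ℤ) - 1) = -(i : ℤ) - 1 - 1 by ring]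
    push_cast
    module

theorem formClass_pt_right (f : CoordRing p) : formClass p f (pt p) =
    ∑ j ∈ Finset.range (p.natDegree + 1),
      ((j : ℂ) * p.coeff j) • formClass p (f * t p (j - 1)) (t p 1) := by
  rw [pt_eq_sum, formClass_eq, map_sum]
  refine Finset.sum_congr rfl fun j _ => ?_
  rw [map_smul, ← formClass_eq, formClass_t_right, smul_smul, mul_comm (j : ℂ)]
  simp

theorem formClass_t (k : ℤ) :
    formClass p (t p k) (t p 1) = if k = -1 then omega p 0 else 0 := by
  split_ifs with h
  · rw [h, omega, if_pos rfl]
  · have h₁ := formClass_t_right (p := p) 1 (k + 1)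
    rw [formClass_eq, modExactClass_one_left, one_mul, add_sub_cancel_right] at h₁
    refine (smul_eq_zero.mp h₁.symm).resolve_left ?_
    have : k + 1 ≠ 0 := by omega
    exact_mod_cast this

theorem formClass_t_t (i j : ℤ) :
    formClass p (t p i) (t p j) = (if i + j = 0 then (j : ℂ) else 0) • omega p 0 := by
  rw [formClass_t_right, t_mul_t, formClass_t]
  by_cases h : i + j = 0
  · rw [if_pos (by omega), if_pos h]
  · rw [if_neg (by omega), if_neg h, smul_zero, zero_smul]

theorem formClass_tu_t (i j : ℤ) : formClass p (t p i * u p) (t p j) =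
    (j : ℂ) • formClass p (t p (i + j - 1) * u p) (t p 1) := by
  rw [formClass_t_right, mul_right_comm, t_mul_t, add_sub_assoc]

/-- `u du` is half of `dp`. -/
theorem formClass_mul_u_u (f : CoordRing p) :
    formClass p (f * u p) (u p) = (1 / 2 : ℂ) • formClass p f (pt p) := by
  have h := formClass_mul_right f (u p) (u p)
  rw [u_mul_u] at h
  rw [h]
  module

theorem formClass_tu_tu (i j : ℤ) : formClass p (t p i * u p) (t p j * u p) =
    (∑ k ∈ Finset.range (p.natDegree + 1),
      ((j : ℂ) + (k : ℂ) / 2) * p.coeff k * (if i + j = -(k : ℤ) then 1 else 0)) •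
        omega p 0 := by
  rw [formClass_mul_right, mul_right_comm, formClass_mul_u_u, formClass_pt_right, mul_assoc,
    u_mul_u, formClass_t_right, pt_eq_sum, Finset.mul_sum, Finset.sum_mul, formClass_eq, map_sum,
    LinearMap.sum_apply, Finset.smul_sum, Finset.smul_sum, ← Finset.sum_add_distrib,
    Finset.sum_smul]
  refine Finset.sum_congr rfl fun k _ => ?_
  rw [mul_smul_comm, smul_mul_assoc, map_smul, LinearMap.smul_apply, ← formClass_eq, t_mul_t,
    t_mul_t, t_mul_t, t_mul_t, formClass_t, formClass_t]
  by_cases h : i + j = -(k : ℤ)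
  · rw [if_pos (by omega), if_pos (by omega), if_pos h]
    module
  · rw [if_neg (by omega), if_neg (by omega), if_neg h]
    simp

/-- The recurrence for the classes `t ^ k u dt`, which expresses that `d(t ^ m p u)` is exact. -/
theorem sum_smul_formClass_tu (m : ℤ) : ∑ j ∈ Finset.range (p.natDegree + 1),
    ((2 * (m : ℂ) + 3 * j) * p.coeff j) • formClass p (t p (m - 1 + j) * u p) (t p 1) = 0 := by
  have h₀ : formClass p 1 (t p m * (pt p * u p)) = 0 := modExactClass_one_left _
  rw [formClass_mul_right, one_mul, one_mul, formClass_mul_right, ← u_mul_u, ← mul_assoc,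
    formClass_mul_u_u, u_mul_u, formClass_pt_right, formClass_t_right, pt_eq_sum, Finset.sum_mul,
    Finset.sum_mul, formClass_eq _ (∑ _ ∈ _, _), map_sum, LinearMap.sum_apply, Finset.smul_sum,
    Finset.smul_sum, ← Finset.sum_add_distrib, ← Finset.sum_add_distrib] at h₀
  refine (Eq.trans ?_ (congrArg (fun c => (2 : ℂ) • c) h₀)).trans (smul_zero _)
  rw [Finset.smul_sum]
  refine Finset.sum_congr rfl fun j _ => ?_
  rw [smul_mul_assoc, smul_mul_assoc, map_smul, LinearMap.smul_apply, ← formClass_eq,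
    mul_right_comm (t p m), t_mul_t, mul_right_comm (t p j), t_mul_t,
    show m + ((j : ℤ) - 1) = m - 1 + j by ring, show (j : ℤ) + (m - 1) = m - 1 + j by ring]
  module

theorem omega_eq {k : ℕ} (hk : 1 ≤ k) :
    omega p k = formClass p (t p (-(k : ℤ)) * u p) (t p 1) := if_neg (by omega)

theorem psi_eq (hmonic : p.Monic) (hdeg : 1 ≤ p.natDegree) (h0 : p.coeff 0 ≠ 0) (i j : ℤ) :
    psi p i j = formClass p (t p (i + j - 1) * u p) (t p 1) := by
  have hω (c : ℕ → ℂ) : ∑ k ∈ Finset.Icc 1 p.natDegree, c k • omega p k =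
      ∑ k ∈ Finset.Icc 1 p.natDegree, c k • formClass p (t p (-(k : ℤ)) * u p) (t p 1) :=
    Finset.sum_congr rfl fun k hk => by rw [omega_eq (Finset.mem_Icc.mp hk).1]
  rw [psi]
  split_ifs with h
  · rw [hω, ← eq_sum_P_smul (c := fun k => formClass p (t p k * u p) (t p 1)) hmonic
      sum_smul_formClass_tu _ (by omega)]
  · rw [hω, ← eq_sum_Q_smul (c := fun k => formClass p (t p k * u p) (t p 1)) hdeg h0
      sum_smul_formClass_tu _ (by omega)]
    congr 3; ring

theorem psi_mem_span (i j : ℤ) :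
    psi p i j ∈ Submodule.span ℂ (omega p '' Set.Icc 1 p.natDegree) := by
  rw [psi]
  split_ifs <;>
  exact Submodule.sum_mem _ fun k hk => Submodule.smul_mem _ _ <|
    Submodule.subset_span ⟨k, Finset.mem_Icc.mp hk, rfl⟩

theorem formClass_tu_t_eq_psi (hmonic : p.Monic) (hdeg : 1 ≤ p.natDegree) (h0 : p.coeff 0 ≠ 0)
    (i j : ℤ) : formClass p (t p i * u p) (t p j) = (j : ℂ) • psi p i j := by
  rw [formClass_tu_t, psi_eq hmonic hdeg h0]

theorem linearIndependent_omega (hmonic : p.Monic) (hdeg : 1 ≤ p.natDegree)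
    (h0 : p.coeff 0 ≠ 0) :
    LinearIndependent ℂ (fun k : Fin (p.natDegree + 1) => omega p k) := by
  rw [Fintype.linearIndependent_iff]
  intro b hb l
  -- the functional dual to `ω_l`
  obtain ⟨θ, hθ⟩ : ∃ θ : DifferentialsModExact p →ₗ[ℂ] ℂ,
      ∀ k : Fin (p.natDegree + 1), θ (omega p k) = if l = k then 1 else 0 := by
    rcases Nat.eq_zero_or_pos (l : ℕ) with hl | hl
    · obtain ⟨θ, h₁, h₂⟩ := exists_functional (p := p) 1 (c := 0) (by simp)
      refine ⟨θ, fun k => ?_⟩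
      rcases Nat.eq_zero_or_pos (k : ℕ) with hk | hk
      · rw [if_pos (Fin.ext (hl.trans hk.symm)), hk, omega, if_pos rfl, h₁]
      · rw [if_neg (fun h => by rw [h] at hl; omega), omega_eq hk, h₂]; rfl
    · obtain ⟨θ, h₁, h₂⟩ := exists_functional (p := p) 0
        (sum_oddCoeff_eq_zero hdeg h0 hmonic (l : ℕ))
      refine ⟨θ, fun k => ?_⟩
      rcases Nat.eq_zero_or_pos (k : ℕ) with hk | hk
      · rw [if_neg (fun h => by rw [h] at hl; omega), hk, omega, if_pos rfl, h₁]
      · rw [omega_eq hk, h₂, oddCoeff_neg _ (Finset.mem_Icc.mpr ⟨hk, by omega⟩)]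
        exact if_congr Fin.val_inj rfl rfl
  have := congrArg θ hb
  simpa [map_sum, hθ] using this

variable (p) in
theorem span_t_eq_top :
    Submodule.span ℂ (Set.range (t p) ∪ Set.range fun i => t p i * u p) = ⊤ := by
  have hT (F : ℂ[T;T⁻¹] →ₗ[ℂ] CoordRing p) (a : ℂ[T;T⁻¹]) :
      F a ∈ Submodule.span ℂ (Set.range fun i => F (T i)) := by
    have : a ∈ Submodule.span ℂ (Set.range (T : ℤ → ℂ[T;T⁻¹])) := by rw [span_range_T]; trivial
    have := Submodule.mem_map_of_mem (f := F) this
    rwa [Submodule.map_span, ← Set.range_comp] at this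
  rw [eq_top_iff]
  rintro f -
  obtain ⟨a, b, rfl⟩ := exists_eq_add_mul_u p f
  rw [Submodule.span_union]
  exact Submodule.add_mem_sup (hT (ofLaurent p).toLinearMap a)
    (hT (LinearMap.mulRight ℂ (u p) ∘ₗ (ofLaurent p).toLinearMap) b)

theorem span_omega_sup (hmonic : p.Monic) (hdeg : 1 ≤ p.natDegree) (h0 : p.coeff 0 ≠ 0) :
    Submodule.span ℂ {omega p 0} ⊔ Submodule.span ℂ (omega p '' Set.Icc 1 p.natDegree) = ⊤ := by
  rw [eq_top_iff, ← span_modExactClass_eq_top, Submodule.span_le]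
  rintro _ ⟨f, h, rfl⟩
  have hmem (f : CoordRing p) :
      f ∈ Submodule.span ℂ (Set.range (t p) ∪ Set.range fun i => t p i * u p) := by
    rw [span_t_eq_top]; trivial
  refine LinearMap.BilinMap.apply_apply_mem_of_mem_span _ _ _ (modExactClass ℂ (CoordRing p)) ?_
    f h (hmem f) (hmem h)
  have h₀ (c : ℂ) : c • omega p 0 ∈ Submodule.span ℂ {omega p 0} ⊔
      Submodule.span ℂ (omega p '' Set.Icc 1 p.natDegree) :=
    Submodule.mem_sup_left (Submodule.smul_mem _ _ (Submodule.mem_span_singleton_self _))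
  have h₁ (c : ℂ) (i j : ℤ) : c • psi p i j ∈ Submodule.span ℂ {omega p 0} ⊔
      Submodule.span ℂ (omega p '' Set.Icc 1 p.natDegree) :=
    Submodule.mem_sup_right (Submodule.smul_mem _ _ (psi_mem_span i j))
  rintro _ (⟨i, rfl⟩ | ⟨i, rfl⟩) _ (⟨j, rfl⟩ | ⟨j, rfl⟩)
  · rw [← formClass_eq, formClass_t_t]
    exact h₀ _
  · rw [modExactClass_swap, ← formClass_eq, formClass_tu_t_eq_psi hmonic hdeg h0]
    exact Submodule.neg_mem _ (h₁ _ _ _)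
  · rw [← formClass_eq, formClass_tu_t_eq_psi hmonic hdeg h0]
    exact h₁ _ _ _
  · rw [← formClass_eq, formClass_tu_tu]
    exact h₀ _

theorem span_omega_eq_top (hmonic : p.Monic) (hdeg : 1 ≤ p.natDegree) (h0 : p.coeff 0 ≠ 0) :
    Submodule.span ℂ (Set.range fun k : Fin (p.natDegree + 1) => omega p k) = ⊤ := by
  rw [eq_top_iff, ← span_omega_sup hmonic hdeg h0, sup_le_iff, Submodule.span_le,
    Submodule.span_le]
  constructor
  · rintro _ rfl
    exact Submodule.subset_span ⟨0, rfl⟩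
  · rintro _ ⟨k, hk, rfl⟩
    exact Submodule.subset_span ⟨⟨k, by have := hk.2; omega⟩, rfl⟩

end Hyperelliptic

/-! ### The grading -/

namespace Hyperelliptic

open KaehlerDifferential LaurentPolynomial CurrentAlgebra

section Grading

variable {p : ℂ[X]} {g : Type*} [LieRing g] [LieAlgebra ℂ g]

theorem range_rTensor_le_span (F : ℂ[T;T⁻¹] →ₗ[ℂ] CoordRing p) :
    LinearMap.range (LinearMap.rTensor g F) ≤
      Submodule.span ℂ (Set.range fun q : ℤ × g => F (T q.1) ⊗ₜ[ℂ] q.2) := by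
  rintro _ ⟨b, rfl⟩
  induction b with
  | zero => simp
  | add b b' hb hb' => rw [map_add]; exact Submodule.add_mem _ hb hb'
  | tmul a x =>
    have ha : a ∈ Submodule.span ℂ (Set.range (T : ℤ → ℂ[T;T⁻¹])) := by rw [span_range_T]; trivial
    rw [LinearMap.rTensor_tmul]
    induction ha using Submodule.span_induction with
    | mem a ha => obtain ⟨i, rfl⟩ := ha; exact Submodule.subset_span ⟨(i, x), rfl⟩
    | zero => simp
    | add a a' _ _ ha ha' => rw [map_add, TensorProduct.add_tmul]; exact Submodule.add_mem _ ha ha'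
    | smul c a _ ha => rw [map_smul, ← TensorProduct.smul_tmul']; exact Submodule.smul_mem _ _ ha

theorem lie_cocycle_mem {F G : ℂ[T;T⁻¹] →ₗ[ℂ] CoordRing p} {S : Submodule ℂ (Space p g)}
    (h : ∀ (i j : ℤ) (x y : g), (⁅F (T i) ⊗ₜ[ℂ] x, G (T j) ⊗ₜ[ℂ] y⁆,
      cocycle ℂ (CoordRing p) g (F (T i) ⊗ₜ x) (G (T j) ⊗ₜ y)) ∈ S)
    {a b : CoordRing p ⊗[ℂ] g} (ha : a ∈ LinearMap.range (LinearMap.rTensor g F))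
    (hb : b ∈ LinearMap.range (LinearMap.rTensor g G)) :
    (⁅a, b⁆, cocycle ℂ (CoordRing p) g a b) ∈ S := by
  let B := (lieBilin ℂ (CoordRing p ⊗[ℂ] g)).compr₂
      (LinearMap.inl ℂ (CoordRing p ⊗[ℂ] g) (DifferentialsModExact p)) +
    (cocycle ℂ (CoordRing p) g).compr₂
      (LinearMap.inr ℂ (CoordRing p ⊗[ℂ] g) (DifferentialsModExact p))
  have hB (a b : CoordRing p ⊗[ℂ] g) : B a b = (⁅a, b⁆, cocycle ℂ (CoordRing p) g a b) := by
    simp [B, lieBilin_apply]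
  rw [← hB]
  refine LinearMap.BilinMap.apply_apply_mem_of_mem_span S _ _ B ?_ a b
    (range_rTensor_le_span F ha) (range_rTensor_le_span G hb)
  rintro _ ⟨⟨i, x⟩, rfl⟩ _ ⟨⟨j, y⟩, rfl⟩
  rw [hB]
  exact h i j x y

variable (p) in
/-- Multiplication by `u`, as a map `ℂ[t, t⁻¹] → R`. -/
def laurentMulU : ℂ[T;T⁻¹] →ₗ[ℂ] CoordRing p :=
  LinearMap.mulRight ℂ (u p) ∘ₗ (ofLaurent p).toLinearMap

theorem lie_cocycle_even_even {v w : Space p g} (hv : v ∈ evenPart p g) (hw : w ∈ evenPart p g) :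
    (⁅v.1, w.1⁆, cocycle ℂ (CoordRing p) g v.1 w.1) ∈ evenPart p g := by
  refine lie_cocycle_mem (fun i j x y => ?_) hv.1 hw.1
  refine ⟨⟨(T i * T j) ⊗ₜ ⁅x, y⁆, ?_⟩, ?_⟩
  · rw [LinearMap.rTensor_tmul, LieAlgebra.ExtendScalars.bracket_tmul]
    congr 1
    exact map_mul (ofLaurent p) _ _
  · rw [cocycle_tmul]
    change _ • formClass p (t p i) (t p j) ∈ _
    rw [formClass_t_t]
    exact Submodule.smul_mem _ _ (Submodule.smul_mem _ _ (Submodule.mem_span_singleton_self _))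

theorem lie_cocycle_odd_odd {v w : Space p g} (hv : v ∈ oddPart p g) (hw : w ∈ oddPart p g) :
    (⁅v.1, w.1⁆, cocycle ℂ (CoordRing p) g v.1 w.1) ∈ evenPart p g := by
  refine lie_cocycle_mem (F := laurentMulU p) (G := laurentMulU p) (fun i j x y => ?_) hv.1 hw.1
  refine ⟨⟨(T i * T j * Polynomial.toLaurent p) ⊗ₜ ⁅x, y⁆, ?_⟩, ?_⟩
  · rw [LinearMap.rTensor_tmul, LieAlgebra.ExtendScalars.bracket_tmul]
    congr 1
    change ofLaurent p _ = (ofLaurent p (T i) * u p) * (ofLaurent p (T j) * u p)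
    rw [mul_mul_mul_comm, u_mul_u, pt, map_mul, map_mul]
  · rw [cocycle_tmul]
    change _ • formClass p (t p i * u p) (t p j * u p) ∈ _
    rw [formClass_tu_tu]
    exact Submodule.smul_mem _ _ (Submodule.smul_mem _ _ (Submodule.mem_span_singleton_self _))

theorem lie_cocycle_odd_even (hmonic : p.Monic) (hdeg : 1 ≤ p.natDegree) (h0 : p.coeff 0 ≠ 0)
    {v w : Space p g} (hv : v ∈ oddPart p g) (hw : w ∈ evenPart p g) :
    (⁅v.1, w.1⁆, cocycle ℂ (CoordRing p) g v.1 w.1) ∈ oddPart p g := by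
  refine lie_cocycle_mem (F := laurentMulU p) (fun i j x y => ?_) hv.1 hw.1
  refine ⟨⟨(T i * T j) ⊗ₜ ⁅x, y⁆, ?_⟩, ?_⟩
  · rw [LinearMap.rTensor_tmul, LieAlgebra.ExtendScalars.bracket_tmul]
    congr 1
    change ofLaurent p _ * u p = (ofLaurent p (T i) * u p) * ofLaurent p (T j)
    rw [mul_right_comm, map_mul]
  · rw [cocycle_tmul]
    change _ • formClass p (t p i * u p) (t p j) ∈ _
    rw [formClass_tu_t_eq_psi hmonic hdeg h0]
    exact Submodule.smul_mem _ _ (Submodule.smul_mem _ _ (psi_mem_span i j))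

theorem lie_cocycle_even_odd (hmonic : p.Monic) (hdeg : 1 ≤ p.natDegree) (h0 : p.coeff 0 ≠ 0)
    {v w : Space p g} (hv : v ∈ evenPart p g) (hw : w ∈ oddPart p g) :
    (⁅v.1, w.1⁆, cocycle ℂ (CoordRing p) g v.1 w.1) ∈ oddPart p g := by
  have h := Submodule.neg_mem _ (lie_cocycle_odd_even hmonic hdeg h0 hw hv)
  rwa [Prod.neg_mk, lie_skew, ← cocycle_swap] at h

theorem isCompl_range_rTensor :
    IsCompl (LinearMap.range (LinearMap.rTensor g (ofLaurent p).toLinearMap))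
      (LinearMap.range (LinearMap.rTensor g (laurentMulU p))) := by
  have hid : (ofLaurent p).toLinearMap ∘ₗ coord p 0 + laurentMulU p ∘ₗ coord p 1 =
      LinearMap.id := by
    ext f
    obtain ⟨a, b, rfl⟩ := exists_eq_add_mul_u p f
    simp only [LinearMap.add_apply, LinearMap.comp_apply, coord_zero_eq, coord_one_eq]
    rfl
  have h₀ : coord p 0 ∘ₗ laurentMulU p = 0 := LinearMap.ext fun a => (coord_of_mul_u a).1
  have h₁ : coord p 1 ∘ₗ (ofLaurent p).toLinearMap = 0 := LinearMap.ext fun a => (coord_of a).2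
  have hid' (z : CoordRing p ⊗[ℂ] g) :
      LinearMap.rTensor g (ofLaurent p).toLinearMap (LinearMap.rTensor g (coord p 0) z) +
        LinearMap.rTensor g (laurentMulU p) (LinearMap.rTensor g (coord p 1) z) = z := by
    rw [← LinearMap.comp_apply, ← LinearMap.comp_apply, ← LinearMap.rTensor_comp,
      ← LinearMap.rTensor_comp, ← LinearMap.add_apply, ← LinearMap.rTensor_add, hid,
      LinearMap.rTensor_id, LinearMap.id_apply]
  constructor
  · rw [Submodule.disjoint_def]
    rintro z ⟨x, hx⟩ ⟨y, hy⟩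
    rw [← hid' z]
    conv_lhs => rw [← hy]
    nth_rewrite 2 [hy]
    rw [← hx, ← LinearMap.comp_apply (LinearMap.rTensor g (coord p 0)),
      ← LinearMap.comp_apply (LinearMap.rTensor g (coord p 1)), ← LinearMap.rTensor_comp,
      ← LinearMap.rTensor_comp, h₀, h₁]
    simp
  · rw [codisjoint_iff, eq_top_iff]
    rintro z -
    rw [← hid' z]
    exact Submodule.add_mem_sup ⟨_, rfl⟩ ⟨_, rfl⟩

theorem isCompl_span_omega (hmonic : p.Monic) (hdeg : 1 ≤ p.natDegree) (h0 : p.coeff 0 ≠ 0) :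
    IsCompl (Submodule.span ℂ {omega p 0})
      (Submodule.span ℂ (omega p '' Set.Icc 1 p.natDegree)) := by
  refine ⟨?_, codisjoint_iff.mpr (span_omega_sup hmonic hdeg h0)⟩
  have h := (linearIndependent_omega hmonic hdeg h0).disjoint_span_image
    (s := {0}) (t := {0}ᶜ) disjoint_compl_right
  refine h.mono (Submodule.span_mono ?_) (Submodule.span_mono ?_)
  · rintro _ rfl
    exact ⟨0, rfl, rfl⟩
  · rintro _ ⟨k, hk, rfl⟩
    rw [Set.mem_Icc] at hk
    refine ⟨⟨k, by omega⟩, fun h => ?_, rfl⟩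
    have := congrArg Fin.val (Set.mem_singleton_iff.mp h)
    simp at this
    omega

theorem isCompl_evenPart_oddPart (hmonic : p.Monic) (hdeg : 1 ≤ p.natDegree)
    (h0 : p.coeff 0 ≠ 0) : IsCompl (evenPart p g) (oddPart p g) := by
  have h₁ := isCompl_range_rTensor (p := p) (g := g)
  have h₂ := isCompl_span_omega hmonic hdeg h0
  constructor
  · rw [Submodule.disjoint_def]
    intro v hv hw
    exact Prod.ext (Submodule.disjoint_def.mp h₁.disjoint _ hv.1 hw.1)
      (Submodule.disjoint_def.mp h₂.disjoint _ hv.2 hw.2)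
  · rw [codisjoint_iff, evenPart, oddPart, Submodule.prod_sup_prod, h₂.sup_eq_top]
    change Submodule.prod (_ ⊔ LinearMap.range (LinearMap.rTensor g (laurentMulU p))) _ = ⊤
    rw [h₁.sup_eq_top, Submodule.prod_top]

theorem nonempty_gradedLieAlgebra (hmonic : p.Monic) (hdeg : 1 ≤ p.natDegree)
    (h0 : p.coeff 0 ≠ 0) :
    Nonempty (GradedLieAlgebra fun r : ZMod 2 => (part p g r).map
      (Extension.ofProd ℂ (CoordRing p) g : Space p g →ₗ[ℂ] Extension ℂ (CoordRing p) g)) := by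
  have h01 (r : ZMod 2) : r = 0 ∨ r = 1 := by revert r; decide
  have hp0 : part p g 0 = evenPart p g := if_pos rfl
  have hp1 : part p g 1 = oddPart p g := if_neg (by decide)
  have hint : DirectSum.IsInternal fun r : ZMod 2 => (part p g r).map
      (Extension.ofProd ℂ (CoordRing p) g : Space p g →ₗ[ℂ] Extension ℂ (CoordRing p) g) := by
    rw [DirectSum.isInternal_submodule_iff_isCompl _ (i := 0) (j := 1) (by decide)
      (Set.ext fun r => by simpa using h01 r), hp0, hp1]
    exact (Submodule.orderIsoMapComap (Extension.ofProd ℂ (CoordRing p) g)).isCompl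
      (isCompl_evenPart_oddPart hmonic hdeg h0)
  refine ⟨{ hint.chooseDecomposition with bracket_mem := ?_ }⟩
  rintro r s _ _ ⟨v, hv, rfl⟩ ⟨w, hw, rfl⟩
  refine ⟨(⁅v.1, w.1⁆, cocycle ℂ (CoordRing p) g v.1 w.1), ?_, rfl⟩
  have h11 : (1 + 1 : ZMod 2) = 0 := by decide
  rcases h01 r with rfl | rfl <;> rcases h01 s with rfl | rfl <;>
    simp only [SetLike.mem_coe, add_zero, zero_add, h11, hp0, hp1] at hv hw ⊢
  · exact lie_cocycle_even_even hv hw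
  · exact lie_cocycle_even_odd hmonic hdeg h0 hv hw
  · exact lie_cocycle_odd_even hmonic hdeg h0 hv hw
  · exact lie_cocycle_odd_odd hv hw

end Grading

end Hyperelliptic

end

theorem mainTheorem1 (p : ℂ[X]) (hmonic : p.Monic) (hsep : p.Separable)
    (hdeg : 1 ≤ p.natDegree) (h0 : p.coeff 0 ≠ 0)
    (g : Type u) [LieRing g] [LieAlgebra ℂ g] [FiniteDimensional ℂ g] [LieAlgebra.IsSimple ℂ g] :
    -- `ω₀, …, ω_n` is a basis of `Ω¹_R / dR`
    (LinearIndependent ℂ (fun k : Fin (p.natDegree + 1) => Hyperelliptic.omega p k) ∧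
      Submodule.span ℂ (Set.range fun k : Fin (p.natDegree + 1) => Hyperelliptic.omega p k) = ⊤) ∧
    -- the Lie algebra `L`, with underlying vector space `(𝔤 ⊗ R) ⊕ Ω¹_R / dR`
    ∃ (L : Type u) (_ : LieRing L) (_ : LieAlgebra ℂ L)
      (e : Hyperelliptic.Space p g ≃ₗ[ℂ] L)
      (π : L →ₗ⁅ℂ⁆ (Hyperelliptic.CoordRing p ⊗[ℂ] g)),
      -- is the universal central extension of `𝔤 ⊗ R` through the projection
      (∀ v, π (e v) = v.1) ∧
      IsUniversalCentralExtension.{w} π ∧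
      -- is graded by `ℤ / 2`
      Nonempty (GradedLieAlgebra fun r : ZMod 2 =>
        (Hyperelliptic.part p g r).map (e : Hyperelliptic.Space p g →ₗ[ℂ] L)) ∧
      -- and has the following bracket
      (∀ (c : Hyperelliptic.DifferentialsModExact p) (v : L), ⁅e (0, c), v⁆ = 0) ∧
      (∀ (x y : g) (i j : ℤ),
        ⁅e (Hyperelliptic.t p i ⊗ₜ[ℂ] x, 0), e (Hyperelliptic.t p j ⊗ₜ[ℂ] y, 0)⁆ =
          e (Hyperelliptic.t p (i + j) ⊗ₜ[ℂ] ⁅x, y⁆,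
            (if i + j = 0 then (j : ℂ) * killingForm ℂ g x y else 0) •
              Hyperelliptic.omega p 0)) ∧
      (∀ (x y : g) (i j : ℤ),
        ⁅e ((Hyperelliptic.t p i * Hyperelliptic.u p) ⊗ₜ[ℂ] x, 0),
          e ((Hyperelliptic.t p j * Hyperelliptic.u p) ⊗ₜ[ℂ] y, 0)⁆ =
          e ((Hyperelliptic.t p (i + j) * Hyperelliptic.pt p) ⊗ₜ[ℂ] ⁅x, y⁆,
            (killingForm ℂ g x y * ∑ k ∈ Finset.range (p.natDegree + 1),
              ((j : ℂ) + (k : ℂ) / 2) * p.coeff k * (if i + j = -(k : ℤ) then 1 else 0)) •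
              Hyperelliptic.omega p 0)) ∧
      (∀ (x y : g) (i j : ℤ),
        ⁅e ((Hyperelliptic.t p i * Hyperelliptic.u p) ⊗ₜ[ℂ] x, 0),
          e (Hyperelliptic.t p j ⊗ₜ[ℂ] y, 0)⁆ =
          e ((Hyperelliptic.t p (i + j) * Hyperelliptic.u p) ⊗ₜ[ℂ] ⁅x, y⁆,
            ((j : ℂ) * killingForm ℂ g x y) • Hyperelliptic.psi p i j)) := by
  refine ⟨⟨Hyperelliptic.linearIndependent_omega hmonic hdeg h0,
    Hyperelliptic.span_omega_eq_top hmonic hdeg h0⟩,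
    CurrentAlgebra.Extension ℂ (Hyperelliptic.CoordRing p) g, inferInstance, inferInstance,
    CurrentAlgebra.Extension.ofProd ℂ (Hyperelliptic.CoordRing p) g,
    CurrentAlgebra.Extension.proj ℂ (Hyperelliptic.CoordRing p) g, fun _ => rfl,
    CurrentAlgebra.isUniversalCentralExtension_proj ℂ (Hyperelliptic.CoordRing p) g,
    Hyperelliptic.nonempty_gradedLieAlgebra hmonic hdeg h0,
    CurrentAlgebra.Extension.lie_ofProd_zero_left, fun x y i j => ?_, fun x y i j => ?_,
    fun x y i j => ?_⟩
  · rw [CurrentAlgebra.Extension.lie_ofProd, CurrentAlgebra.cocycle_tmul,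
      LieAlgebra.ExtendScalars.bracket_tmul, Hyperelliptic.t_mul_t, ← Hyperelliptic.formClass_eq,
      Hyperelliptic.formClass_t_t, smul_smul, mul_ite, mul_zero, mul_comm (j : ℂ)]
  · rw [CurrentAlgebra.Extension.lie_ofProd, CurrentAlgebra.cocycle_tmul,
      LieAlgebra.ExtendScalars.bracket_tmul, mul_mul_mul_comm, Hyperelliptic.u_mul_u,
      Hyperelliptic.t_mul_t, ← Hyperelliptic.formClass_eq, Hyperelliptic.formClass_tu_tu,
      smul_smul]
  · rw [CurrentAlgebra.Extension.lie_ofProd, CurrentAlgebra.cocycle_tmul,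
      LieAlgebra.ExtendScalars.bracket_tmul, mul_right_comm, Hyperelliptic.t_mul_t,
      ← Hyperelliptic.formClass_eq, Hyperelliptic.formClass_tu_t_eq_psi hmonic hdeg h0, smul_smul,
      mul_comm (j : ℂ)]
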